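/- Let $A$ be a finite alphabet and let $h : A^* \to A^*$ be a morphism. Write $\Psi(w) \in \mathbb{Z}^A$ for the Parikh vector of a word $w$ (its $a$-th coordinate is the number of occurrences of the letter $a$ in $w$). Let $M_h$ be the $A \times A$ matrix whose $(a,b)$ entry is the number of occurrences of $a$ in $h(b)$; the eigenvalues of $h$ are the complex eigenvalues of $M_h$. The morphism $h$ is primitive if there is $m \in \mathbb{N}$ such that, for every $a \in A$, the word $h^m(a)$ contains all the letters of $A$. Let $\operatorname{Fact}^\infty(h)$ be the set of all words that are factors (contiguous subwords) of $h^i(a)$ for some $i \ge 1$ and $a \in A$. For $k \ge 1$, a $k$-template over $A$ is a tuple $t = [a_1, \ldots, a_{k+1}, \mathbf{d}_1, \ldots, \mathbf{d}_{k-1}]$ with $a_i \in A \cup \{\varepsilon\}$ and $\mathbf{d}_i \in \mathbb{Z}^A$. A word $w$ realizes $t$ if there are $w_1, \ldots, w_k \in A^*$ with $w = a_1 w_1 a_2 w_2 \cdots w_k a_{k+1}$ and $\Psi(w_{i+1}) - \Psi(w_i) = \mathbf{d}_i$ for all $i \in \{1, \ldots, k-1\}$. Theorem. For any primitive morphism $h$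 with no eigenvalue of absolute value $1$ and any $k$-template $t_0$, it is decidable whether some word of $\operatorname{Fact}^\infty(h)$ realizes $t_0$. That is, there is a single algorithm (a partial recursive function) which, given as input the images of the letters under any such $h$ over an alphabet $\{0, \ldots, n-1\}$ ($n \in \mathbb{N}$) and any $k$-template $t_0$ over this alphabet (for any $k \ge 1$), halts and answers correctly whether some word of $\operatorname{Fact}^\infty(h)$ realizes $t_0$. -/

import Mathlib

namespace AbelianTemplates

/-- The Parikh vector of a word: it counts the occurrences of each letter. -/
def parikh {α : Type*} [DecidableEq α] (w : List α) : α → ℤ :=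
  fun a => (w.count a : ℤ)

/-- The word `h^i(a)`, for a morphism `h` of the free monoid, an exponent `i` and a letter `a`. -/
def iterImage {α : Type*} (h : FreeMonoid α →* FreeMonoid α) (i : ℕ) (a : α) : List α :=
  ((⇑h)^[i] (FreeMonoid.of a)).toList

/-- `Fact^∞(h)`: the words that are factors (contiguous subwords) of `h^i(a)`
for some `i ≥ 1` and some letter `a`. -/
def factInf {α : Type*} (h : FreeMonoid α →* FreeMonoid α) : Set (List α) :=
  {u | ∃ i : ℕ, 1 ≤ i ∧ ∃ a : α, u <:+: iterImage h i a}

/-- `h` is primitive: for some `k` every `h^k(a)` contains all the letters. -/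
def IsPrimitive {α : Type*} (h : FreeMonoid α →* FreeMonoid α) : Prop :=
  ∃ k : ℕ, ∀ a b : α, b ∈ iterImage h k a

/-- The matrix `M_h` of a morphism; its `(a, b)` entry is the number of letters `a` in `h(b)`. -/
def incMatrix {α : Type*} [DecidableEq α] (h : FreeMonoid α →* FreeMonoid α) : Matrix α α ℤ :=
  Matrix.of fun a b => parikh (h (FreeMonoid.of b)).toList a

/-- `z` is an eigenvalue of `h`, that is, a complex eigenvalue of the matrix `M_h`. -/
def IsEigenvalue {α : Type*} [Fintype α] [DecidableEq α]
    (h : FreeMonoid α →* FreeMonoid α) (z : ℂ) : Prop :=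
  Module.End.HasEigenvalue (Matrix.toLin' ((incMatrix h).map (Int.cast : ℤ → ℂ))) z

/-- A `k`-template `[a₁, …, a_{k+1}, d₁, …, d_{k-1}]` (for `k ≥ 1`), where each `a_i` is a letter
or the empty word (`none`) and each `d_i` is an integer vector indexed by the letters.
All indices are shifted by one, so that they start at `0`. -/
structure Template (α : Type*) (k : ℕ) where
  letters : Fin (k + 1) → Option α
  diffs : Fin (k - 1) → α → ℤ

/-- The word `w` realizes the template `t`: it can be written `a₁ w₁ a₂ w₂ ⋯ w_k a_{k+1}`
with `Ψ(w_{i+1}) - Ψ(w_i) = d_i` for all `1 ≤ i ≤ k - 1`. -/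
def Realizes {α : Type*} [DecidableEq α] {k : ℕ} (w : List α) (t : Template α k) : Prop :=
  ∃ v : Fin k → List α,
    w = (List.ofFn fun i : Fin k => (t.letters i.castSucc).toList ++ v i).flatten
          ++ (t.letters (Fin.last k)).toList ∧
    ∀ i : Fin (k - 1),
      parikh (v ⟨i.val + 1, by omega⟩) - parikh (v ⟨i.val, by omega⟩) = t.diffs i

/-- The template `t` is realizable by `h`: some word of `Fact^∞(h)` realizes it. -/
def Realizable {α : Type*} [DecidableEq α] {k : ℕ}
    (h : FreeMonoid α →* FreeMonoid α) (t : Template α k) : Prop :=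
  ∃ w ∈ factInf h, Realizes w t

/-- The finite data handed to an algorithm: the list of the images of the letters,
the list of the entries `a_i` of a template, the list of the coordinates of its vectors. -/
abbrev Code : Type := List (List ℕ) × List (Option ℕ) × List (List ℤ)

/-- The description of a morphism `h` on the alphabet `{0, …, n - 1}` and a `k`-template `t`:
the words `h(0), …, h(n - 1)`, then `a₁, …, a_{k+1}`, then `d₁, …, d_{k-1}`.
(The numbers `n` and `k` can be read off from the lengths of the lists.) -/
def code {n k : ℕ} (h : FreeMonoid (Fin n) →* FreeMonoid (Fin n)) (t : Template (Fin n) k) :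
    Code :=
  (List.ofFn fun a : Fin n => (h (FreeMonoid.of a)).toList.map Fin.val,
    List.ofFn fun i : Fin (k + 1) => (t.letters i).map Fin.val,
    List.ofFn fun i : Fin (k - 1) => List.ofFn (t.diffs i))

end AbelianTemplates

namespace AbelianTemplates

open Matrix

/-! ### Integer matrices with no eigenvalue on the unit circle. -/

section Hyperbolic

variable {n : Type*} [Fintype n] [DecidableEq n]

/-! A realization of a template inside `h^i(a)` is a choice of `k + 1` cut positions. Whether the
cuts realize the template depends only on their state: the letter after each cut, the order of the
cuts, and the second differences of the Parikh vectors of the prefixes they bound. Each cut in the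
image of a word has an ancestor cut in that word and an offset in the image of a letter. The state
of the descendants is a function of the state of the ancestors and of the offsets
(`SameState.flatMap`); on second differences this function is affine, `d ↦ T d + c`, where `T` is
the incidence matrix and `c` is bounded.

Followed through the powers of `h^N`, the second differences are bounded at the bottom by the length
of the starting word, and at the top by the template. Hyperbolicity bounds them in between: for a
suitable `N`, the matrix `T = M_h^N` makes `T (1 - T²)⁻¹` so small that the second difference at an
interior level is dominated by those one level below and one level above, and a discrete maximum
principle applies (`IsCutChain.abs_secondDiff_le`). Hence only finitely many states occur. A state
that occurs twice lets the levels in between be excised, so a realizable template is already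
realized in a bounded power (`exists_sameState_lt_numStates`,
`realizable_iff_exists_isRealization`).

To find `N` (`exists_hyperbolicity_certificate`), `M^N (1 - M^(2N))⁻¹` is written as an alternating
average of `z (z - M)⁻¹` over the `2N`-th roots of unity. This function is continuous on the unit
circle, so the average tends to `0`.

The smallness is witnessed by an integer matrix and can be checked by integer arithmetic. The
algorithm therefore searches for a certificate and then makes the finite search that the certificate
bounds. -/

theorem isUnit_det_smul_one_sub {M : Matrix n n ℂ}
    (hM : ∀ z : ℂ, Module.End.HasEigenvalue (Matrix.toLin' M) z → ‖z‖ ≠ 1) {z : ℂ}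
    (hz : ‖z‖ = 1) : IsUnit (z • (1 : Matrix n n ℂ) - M).det := by
  rw [isUnit_iff_ne_zero]
  intro h0
  obtain ⟨v, hv, hv0⟩ := Matrix.exists_mulVec_eq_zero_iff.2 h0
  refine hM z ?_ hz
  refine Module.End.hasEigenvalue_of_hasEigenvector (x := v) ⟨?_, hv⟩
  rw [Module.End.mem_eigenspace_iff, Matrix.toLin'_apply]
  rw [Matrix.sub_mulVec, Matrix.smul_mulVec, Matrix.one_mulVec, sub_eq_zero] at hv0
  exact hv0.symm

/-- The function `z (z - M)⁻¹`. -/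
noncomputable def resolventFun (M : Matrix n n ℂ) (z : ℂ) : Matrix n n ℂ :=
  z • (z • (1 : Matrix n n ℂ) - M)⁻¹

theorem continuousOn_resolventFun {M : Matrix n n ℂ}
    (hM : ∀ z : ℂ, Module.End.HasEigenvalue (Matrix.toLin' M) z → ‖z‖ ≠ 1) (a b : n) :
    ContinuousOn (fun z => resolventFun M z a b) (Metric.sphere 0 1) := by
  have h1 : (fun z => resolventFun M z a b) = fun z : ℂ => z *
      (((z • (1 : Matrix n n ℂ) - M).det)⁻¹ * (z • (1 : Matrix n n ℂ) - M).adjugate a b) := by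
    funext z
    simp [resolventFun, Matrix.inv_def, Ring.inverse_eq_inv']
  rw [h1]
  have hc : Continuous fun z : ℂ => z • (1 : Matrix n n ℂ) - M := by fun_prop
  refine continuousOn_id.mul (ContinuousOn.mul (ContinuousOn.inv₀ ?_ ?_) ?_)
  · exact hc.matrix_det.continuousOn
  · intro z hz
    exact (isUnit_det_smul_one_sub hM (by simpa using hz)).ne_zero
  · exact (hc.matrix_adjugate.matrix_elem a b).continuousOn

/-- The geometric sum telescopes: `(z - M) ∑ z^(K-1-i) M^i = z^K - M^K = 1 - M^K`. -/
theorem resolventFun_mul {M : Matrix n n ℂ}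
    (hM : ∀ z : ℂ, Module.End.HasEigenvalue (Matrix.toLin' M) z → ‖z‖ ≠ 1) {z : ℂ}
    (hz : ‖z‖ = 1) {K : ℕ} (hK : z ^ K = 1) :
    resolventFun M z * (1 - M ^ K) = ∑ i ∈ Finset.range K, (z⁻¹) ^ i • M ^ i := by
  have hz0 : z ≠ 0 := by rintro rfl; simp at hz
  have hcomm : Commute (z • (1 : Matrix n n ℂ)) M := (Commute.one_left M).smul_left z
  have h2 : (z • (1 : Matrix n n ℂ) - M) *
      ∑ i ∈ Finset.range K, (z • (1 : Matrix n n ℂ)) ^ (K - 1 - i) * M ^ i = 1 - M ^ K := by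
    have h3 := (hcomm.symm).mul_geom_sum₂ K
    have h4 : (z • (1 : Matrix n n ℂ)) ^ K = 1 := by rw [smul_pow, hK]; simp
    rw [h4] at h3
    rw [← neg_inj, ← neg_mul, neg_sub, neg_sub, ← h3]
    congr 1
    refine Finset.sum_congr rfl fun i _ => ?_
    exact ((hcomm.pow_left _).pow_right _).eq
  rw [← h2, resolventFun, Matrix.smul_mul, ← Matrix.mul_assoc,
    Matrix.nonsing_inv_mul _ (isUnit_det_smul_one_sub hM hz), Matrix.one_mul, Finset.smul_sum]
  refine Finset.sum_congr rfl fun i hi => ?_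
  have hi' : i < K := Finset.mem_range.1 hi
  rw [smul_pow, one_pow, Matrix.smul_mul, Matrix.one_mul, smul_smul]
  congr 1
  rw [← pow_succ']
  have : z ^ (K - 1 - i + 1) * z ^ i = 1 := by
    rw [← pow_add, ← hK]; congr 1; omega
  rw [inv_pow]
  exact eq_inv_of_mul_eq_one_left this

/-- Discrete Fourier inversion: summing over the `K`-th roots of unity kills every term of the
geometric sum except `i = s`. -/
theorem sum_resolventFun_mul {M : Matrix n n ℂ}
    (hM : ∀ z : ℂ, Module.End.HasEigenvalue (Matrix.toLin' M) z → ‖z‖ ≠ 1) {K : ℕ} {ω : ℂ}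
    (hω : IsPrimitiveRoot ω K) {s : ℕ} (hs : s < K) :
    (∑ k ∈ Finset.range K, (ω ^ s) ^ k • resolventFun M (ω ^ k)) * (1 - M ^ K)
      = (K : ℂ) • M ^ s := by
  have hK : K ≠ 0 := by omega
  have hω1 : ‖ω‖ = 1 := hω.norm'_eq_one hK
  have hω0 : ω ≠ 0 := by rintro rfl; simp at hω1
  rw [Finset.sum_mul]
  have h1 : ∀ k ∈ Finset.range K, (ω ^ s) ^ k • resolventFun M (ω ^ k) * (1 - M ^ K)
      = ∑ i ∈ Finset.range K, (ω ^ s * (ω⁻¹) ^ i) ^ k • M ^ i := by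
    intro k _
    rw [Matrix.smul_mul, resolventFun_mul hM (by simp [hω1])
      (by rw [← pow_mul, mul_comm, pow_mul, hω.pow_eq_one, one_pow]), Finset.smul_sum]
    refine Finset.sum_congr rfl fun i _ => ?_
    rw [smul_smul, mul_pow, ← inv_pow, ← pow_mul (ω⁻¹) k i, ← pow_mul (ω⁻¹) i k, mul_comm i k]
  rw [Finset.sum_congr rfl h1, Finset.sum_comm, Finset.sum_eq_single s]
  · rw [← Finset.sum_smul]
    congr 1
    rw [← mul_pow, mul_inv_cancel₀ hω0]
    simp
  · intro i hi his
    have hi' : i < K := Finset.mem_range.1 hi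
    rw [← Finset.sum_smul]
    have hne : ω ^ s * ω⁻¹ ^ i ≠ 1 := by
      intro h
      rw [inv_pow] at h
      have h2 : ω ^ s = ω ^ i := by
        rw [mul_inv_eq_one₀ (pow_ne_zero _ hω0)] at h; exact h
      exact his (hω.pow_inj hi' hs h2.symm)
    have h3 : (ω ^ s * ω⁻¹ ^ i) ^ K = 1 := by
      rw [mul_pow, ← pow_mul, ← pow_mul, mul_comm s, mul_comm i, pow_mul, pow_mul, inv_pow,
        hω.pow_eq_one]; simp
    have h4 := mul_neg_geom_sum (ω ^ s * ω⁻¹ ^ i) K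
    rw [h3, sub_self, mul_eq_zero] at h4
    rcases h4 with h4 | h4
    · exact absurd (sub_eq_zero.1 h4).symm hne
    · rw [h4, zero_smul]
  · intro h; exact absurd (Finset.mem_range.2 hs) h

/-- Terms `2j` and `2j + 1` have opposite signs and their arguments get close as `N` grows. By
uniform continuity each of the `N` pairs contributes at most `ε`. -/
theorem exists_alternating_sum_le {F : ℂ → ℂ} (hF : ContinuousOn F (Metric.sphere 0 1))
    {ε : ℝ} (hε : 0 < ε) :
    ∃ N₀ : ℕ, ∀ N ≥ N₀, ∀ ω : ℂ, ω = Complex.exp (2 * Real.pi * Complex.I / (2 * N : ℕ)) →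
      ‖∑ k ∈ Finset.range (2 * N), (-1 : ℂ) ^ k * F (ω ^ k)‖ ≤ N * ε := by
  have huc := (isCompact_sphere (0 : ℂ) 1).uniformContinuousOn_of_continuous hF
  rw [Metric.uniformContinuousOn_iff] at huc
  obtain ⟨δ, hδ, hd⟩ := huc ε hε
  have ht : Filter.Tendsto (fun N : ℕ => Complex.exp (2 * Real.pi * Complex.I / (2 * N : ℕ)))
      Filter.atTop (nhds 1) := by
    have h1 : Filter.Tendsto (fun N : ℕ => (2 * Real.pi * Complex.I / (2 * N : ℕ) : ℂ))
        Filter.atTop (nhds 0) := by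
      have := tendsto_const_div_atTop_nhds_zero_nat (𝕜 := ℂ) (Real.pi * Complex.I)
      refine this.congr fun N => ?_
      push_cast
      rw [mul_assoc, mul_div_mul_left _ _ two_ne_zero]
    have h2 := (Complex.continuous_exp.tendsto 0).comp h1
    simpa [Function.comp_def] using h2
  obtain ⟨N₀, hN₀⟩ := Metric.tendsto_atTop.1 ht δ hδ
  refine ⟨N₀, fun N hN ω hω => ?_⟩
  have hω1 : ‖ω‖ = 1 := by
    rw [hω]
    have : (2 * Real.pi * Complex.I / (2 * N : ℕ) : ℂ)
        = ((2 * Real.pi / (2 * N : ℕ) : ℝ) : ℂ) * Complex.I := by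
      push_cast; ring
    rw [this, Complex.norm_exp_ofReal_mul_I]
  have hpair : ∑ k ∈ Finset.range (2 * N), (-1 : ℂ) ^ k * F (ω ^ k)
      = ∑ j ∈ Finset.range N, (F (ω ^ (2 * j)) - F (ω ^ (2 * j + 1))) := by
    clear hN hω
    induction N with
    | zero => simp
    | succ N ih =>
      rw [Nat.mul_succ, Finset.sum_range_succ, Finset.sum_range_succ, ih, Finset.sum_range_succ]
      simp [pow_succ, pow_mul]
      ring
  rw [hpair]
  refine (norm_sum_le _ _).trans ?_
  calc ∑ j ∈ Finset.range N, ‖F (ω ^ (2 * j)) - F (ω ^ (2 * j + 1))‖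
      ≤ ∑ j ∈ Finset.range N, ε := Finset.sum_le_sum fun j _ => ?_
    _ = N * ε := by simp
  rw [← dist_eq_norm]
  refine (hd _ (by simp [hω1]) _ (by simp [hω1]) ?_).le
  rw [dist_eq_norm, pow_succ, ← mul_one_sub, norm_mul, norm_pow, hω1, one_pow, one_mul,
    ← dist_eq_norm, dist_comm, hω]
  exact hN₀ N hN

/-- A matrix of integers without eigenvalues of absolute value `1` has a positive power `T`
such that `T (1 - T²)⁻¹` is small. -/
theorem exists_hyperbolicity_certificate (M : Matrix n n ℤ)
    (hM : ∀ z : ℂ, Module.End.HasEigenvalue (Matrix.toLin' (M.map (Int.cast : ℤ → ℂ))) z → ‖z‖ ≠ 1)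
    (K : ℕ) :
    ∃ (N q : ℕ) (Z : Matrix n n ℤ), 1 ≤ N ∧ 1 ≤ q ∧ Z - Z * M ^ (2 * N) = (q : ℤ) • M ^ N ∧
      ∀ a b, (K : ℤ) * |Z a b| ≤ q := by
  set Mc : Matrix n n ℂ := M.map (Int.cast : ℤ → ℂ) with hMc
  have hsm : ∀ x : n × n, ∀ᶠ N : ℕ in Filter.atTop, ∀ ω : ℂ,
      ω = Complex.exp (2 * Real.pi * Complex.I / (2 * N : ℕ)) →
      ‖∑ k ∈ Finset.range (2 * N), (-1 : ℂ) ^ k * resolventFun Mc (ω ^ k) x.1 x.2‖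
        ≤ N * (1 / (K + 1)) := by
    intro x
    obtain ⟨N₀, h⟩ := exists_alternating_sum_le (continuousOn_resolventFun hM x.1 x.2)
      (show (0 : ℝ) < 1 / (K + 1) by positivity)
    exact Filter.eventually_atTop.2 ⟨N₀, h⟩
  obtain ⟨N, hN, hN1⟩ :=
    ((Filter.eventually_all.2 hsm).and (Filter.eventually_ge_atTop 1)).exists
  set ω : ℂ := Complex.exp (2 * Real.pi * Complex.I / (2 * N : ℕ)) with hω
  have hprim : IsPrimitiveRoot ω (2 * N) := Complex.isPrimitiveRoot_exp _ (by omega)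
  -- With `s = N`, the Fourier weights `(ω ^ s) ^ k` become the signs `(-1) ^ k`.
  have hωN : ω ^ N = -1 := by
    have h1 : (ω ^ N) ^ 2 = 1 := by rw [← pow_mul, mul_comm, hprim.pow_eq_one]
    rcases sq_eq_sq_iff_eq_or_eq_neg.1 (h1.trans (one_pow 2).symm) with h | h
    · exact absurd h (hprim.pow_ne_one_of_pos_of_lt (by omega) (by omega))
    · exact h
  set B : Matrix n n ℤ := 1 - M ^ (2 * N) with hB
  set φ : Matrix n n ℤ →+* Matrix n n ℂ := (Int.castRingHom ℂ).mapMatrix with hφ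
  have hφM : φ M = Mc := rfl
  have hφB : φ B = 1 - Mc ^ (2 * N) := by rw [hB, map_sub, map_one, map_pow, hφM]
  -- The case `s = 0` exhibits a left inverse of `B` up to the factor `2 * N`.
  have hD : B.det ≠ 0 := by
    intro h0
    have h1 := sum_resolventFun_mul hM hprim (s := 0) (by omega)
    have h4 := congrArg Matrix.det h1
    rw [Matrix.det_mul, ← hφB, hφ, ← RingHom.map_det, h0, map_zero, mul_zero, pow_zero,
      Matrix.det_smul, Matrix.det_one, mul_one] at h4
    exact pow_ne_zero _ (by exact_mod_cast (by omega : 2 * N ≠ 0)) h4.symm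
  -- This is `q M^N B⁻¹` with the denominator `q = |det B|` cleared by Cramer's rule; the sign keeps
  -- `q` positive.
  refine ⟨N, B.det.natAbs, B.det.sign • (M ^ N * B.adjugate), hN1, Int.natAbs_pos.2 hD, ?_, ?_⟩
  · rw [← mul_one_sub, ← hB, Matrix.smul_mul, Matrix.mul_assoc, Matrix.adjugate_mul,
      Matrix.mul_smul, Matrix.mul_one, smul_smul, Int.sign_mul_self_eq_natAbs]
  · intro a b
    set S : Matrix n n ℂ :=
      ∑ k ∈ Finset.range (2 * N), (ω ^ N) ^ k • resolventFun Mc (ω ^ k) with hS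
    have h1 : (B.det : ℂ) * S a b = (2 * N : ℕ) * ((M ^ N * B.adjugate) a b : ℤ) := by
      have h2 := sum_resolventFun_mul hM hprim (s := N) (by omega)
      have h3 := congrArg (· * φ B.adjugate) h2
      simp only [← hφB, Matrix.mul_assoc, ← map_mul, Matrix.mul_adjugate, Matrix.smul_mul] at h3
      rw [← hφM, ← map_pow, ← map_mul] at h3
      have h4 := congrFun (congrFun h3 a) b
      have h5 : φ (B.det • 1) = (B.det : ℂ) • (1 : Matrix n n ℂ) := by
        rw [map_zsmul, map_one, Int.cast_smul_eq_zsmul]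
      rw [h5, Matrix.mul_smul, Matrix.mul_one] at h4
      simpa [hφ] using h4
    have h2 : ‖S a b‖ ≤ N * (1 / (K + 1)) := by
      have := hN (a, b) ω rfl
      simpa [hS, hωN, Matrix.sum_apply] using this
    have h3 := congrArg norm h1
    rw [norm_mul, norm_mul, Complex.norm_intCast, Complex.norm_intCast, Complex.norm_natCast] at h3
    have hNpos : (0 : ℝ) < N := by exact_mod_cast hN1
    rw [Matrix.smul_apply, smul_eq_mul, abs_mul, Int.abs_sign_of_ne_zero hD, one_mul,
      Int.natCast_natAbs]
    generalize (M ^ N * B.adjugate) a b = y at h3 ⊢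
    generalize B.det = D at h3 ⊢
    set x : ℝ := |(y : ℝ)| with hx
    have hx0 : 0 ≤ x := abs_nonneg _
    have hd0 : (0 : ℝ) ≤ |(D : ℝ)| := abs_nonneg _
    have h4 : (2 * N : ℕ) * x ≤ |(D : ℝ)| * (N * (1 / (K + 1))) := by
      rw [← h3]; gcongr
    have h5 : 2 * (K + 1) * x ≤ |(D : ℝ)| := by
      have h6 : N * (2 * (K + 1) * x) ≤ N * |(D : ℝ)| := by
        have h7 := mul_le_mul_of_nonneg_right h4 (show (0 : ℝ) ≤ K + 1 by positivity)
        have h8 : |(D : ℝ)| * (N * (1 / (K + 1))) * (K + 1) = N * |(D : ℝ)| := by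
          field_simp
        rw [h8] at h7
        push_cast at h7
        linarith
      exact le_of_mul_le_mul_left h6 hNpos
    have h6 : (K : ℝ) * x ≤ |(D : ℝ)| := by nlinarith [(Nat.cast_nonneg K : (0 : ℝ) ≤ K)]
    rw [hx] at h6
    exact_mod_cast h6

end Hyperbolic
end AbelianTemplates
namespace AbelianTemplates

/-! ### Parikh vectors and incidence matrices. -/

section Parikh

variable {α : Type*} [DecidableEq α]

theorem parikh_nil : parikh ([] : List α) = 0 := by
  funext a; simp [parikh]

theorem parikh_append (u v : List α) : parikh (u ++ v) = parikh u + parikh v := by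
  funext a; simp [parikh]

theorem parikh_singleton (a : α) : parikh [a] = Pi.single a 1 := by
  funext c
  by_cases hc : c = a
  · subst hc; simp [parikh]
  · simp [parikh, hc, Ne.symm hc]

theorem parikh_nonneg (w : List α) (a : α) : 0 ≤ parikh w a := by simp [parikh]

theorem parikh_le_length (w : List α) (a : α) : parikh w a ≤ w.length := by
  simp only [parikh]; exact_mod_cast List.count_le_length

theorem parikh_take_le (w : List α) (p : ℕ) (a : α) : parikh (w.take p) a ≤ w.length := by
  refine (parikh_le_length _ a).trans ?_
  exact_mod_cast (List.length_take_le' p w)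

/-- The incidence matrix of the substitution of the word `g c` for each letter `c`. -/
def substMatrix (g : α → List α) : Matrix α α ℤ := Matrix.of fun a b => parikh (g b) a

theorem parikh_flatMap [Fintype α] (g : α → List α) (w : List α) :
    parikh (w.flatMap g) = (substMatrix g).mulVec (parikh w) := by
  induction w with
  | nil => simp [parikh_nil]
  | cons c w ih =>
    rw [List.flatMap_cons, parikh_append, ih, ← List.singleton_append, parikh_append,
      Matrix.mulVec_add, parikh_singleton]
    congr 1
    funext a
    simp [substMatrix]

end Parikh

/-! ### Cut positions and their ancestors under a substitution. -/

section Cuts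

variable {α : Type*} (g : α → List α)

/-- The word substituted for an optional letter. -/
def block (o : Option α) : List α := o.elim [] g

/-- `r` is the position of a letter in the block of the letter `o`, and `0` without a letter. -/
def IsOffset (o : Option α) (r : ℕ) : Prop := o.elim (r = 0) fun c => r < (g c).length

/-- The position with offset `r` in the image of the letter at position `p`. -/
def descend (W : List α) (p r : ℕ) : ℕ := ((W.take p).flatMap g).length + r

variable {g}

theorem flatMap_drop_eq (W : List α) (p : ℕ) :
    (W.drop p).flatMap g = block g W[p]? ++ (W.drop (p + 1)).flatMap g := by
  by_cases h : p < W.length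
  · rw [List.drop_eq_getElem_cons h, List.getElem?_eq_getElem h, List.flatMap_cons]; rfl
  · simp [block, List.drop_eq_nil_of_le (not_lt.1 h), h,
      List.drop_eq_nil_of_le ((not_lt.1 h).trans (Nat.le_succ p))]

theorem flatMap_eq_take_append (W : List α) (p : ℕ) :
    W.flatMap g
      = (W.take p).flatMap g ++ (block g W[p]? ++ (W.drop (p + 1)).flatMap g) := by
  rw [← flatMap_drop_eq, ← List.flatMap_append, List.take_append_drop]

theorem IsOffset.le_length {o : Option α} {r : ℕ} (h : IsOffset g o r) :
    r ≤ (block g o).length := by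
  cases o with
  | none => simp [IsOffset] at h; simp [h]
  | some c => exact le_of_lt h

theorem take_flatMap_descend {W : List α} {p r : ℕ} (h : IsOffset g W[p]? r) :
    (W.flatMap g).take (descend g W p r) = (W.take p).flatMap g ++ (block g W[p]?).take r := by
  rw [flatMap_eq_take_append W p, descend, List.take_length_add_append,
    List.take_append_of_le_length h.le_length]

theorem getElem?_flatMap_descend {W : List α} {p r : ℕ} (h : IsOffset g W[p]? r) :
    (W.flatMap g)[descend g W p r]? = (block g W[p]?)[r]? := by
  rw [flatMap_eq_take_append W p, descend, List.getElem?_append_right (Nat.le_add_right _ _),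
    Nat.add_sub_cancel_left]
  by_cases hp : p < W.length
  · rw [List.getElem?_eq_getElem hp] at h ⊢
    have h' : r < (block g (some W[p])).length := h
    rw [List.getElem?_append_left h']
  · simp [List.drop_eq_nil_of_le ((not_lt.1 hp).trans (Nat.le_succ p))]

theorem descend_le_length {W : List α} {p r : ℕ} (h : IsOffset g W[p]? r) :
    descend g W p r ≤ (W.flatMap g).length := by
  rw [flatMap_eq_take_append W p, descend]
  have := h.le_length
  simp only [List.length_append]
  omega

theorem descend_lt_descend {W : List α} {p₁ p₂ r₁ r₂ : ℕ} (h : IsOffset g W[p₁]? r₁)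
    (hp : p₁ < p₂) (hp₂ : p₂ ≤ W.length) : descend g W p₁ r₁ < descend g W p₂ r₂ := by
  have h1 : p₁ < W.length := by omega
  have h2 : W.take p₂ = W.take p₁ ++ (W[p₁] :: (W.take p₂).drop (p₁ + 1)) := by
    conv_lhs => rw [← List.take_append_drop p₁ (W.take p₂)]
    rw [List.take_take, min_eq_left hp.le, List.drop_eq_getElem_cons (by simp; omega)]
    simp
  rw [List.getElem?_eq_getElem h1] at h
  have h3 : r₁ < (g W[p₁]).length := h
  rw [descend, descend, h2]
  simp only [List.flatMap_append, List.flatMap_cons, List.length_append]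
  omega

/-- An offset lies strictly before the end of its block, so cuts with distinct ancestors never
coincide; within one block the offsets decide. -/
theorem descend_le_descend_iff {W : List α} {p₁ p₂ r₁ r₂ : ℕ} (h₁ : IsOffset g W[p₁]? r₁)
    (h₂ : IsOffset g W[p₂]? r₂) (hp₁ : p₁ ≤ W.length) (hp₂ : p₂ ≤ W.length) :
    descend g W p₁ r₁ ≤ descend g W p₂ r₂ ↔ p₁ ≤ p₂ ∧ (p₂ ≤ p₁ → r₁ ≤ r₂) := by
  rcases lt_trichotomy p₁ p₂ with h | h | h
  · have := descend_lt_descend (r₂ := r₂) h₁ h hp₂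
    omega
  · subst h
    simp [descend]
  · have := descend_lt_descend (r₂ := r₁) h₂ h hp₁
    omega

/-- A cut at the end of a block is attributed to the next letter with nonempty image, or to the end
of `W` with offset `0`. Letters with empty image are skipped. -/
theorem exists_descend_eq (W : List α) {x : ℕ} (hx : x ≤ (W.flatMap g).length) :
    ∃ p r, p ≤ W.length ∧ IsOffset g W[p]? r ∧ x = descend g W p r := by
  induction W generalizing x with
  | nil => exact ⟨0, 0, le_rfl, rfl, by simpa [descend] using hx⟩
  | cons c W ih =>
    by_cases h : x < (g c).length
    · exact ⟨0, x, Nat.zero_le _, h, by simp [descend]⟩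
    · rw [List.flatMap_cons, List.length_append] at hx
      obtain ⟨p, r, hp, hr, hxr⟩ := ih (x := x - (g c).length) (by omega)
      refine ⟨p + 1, r, by simpa using hp, by simpa using hr, ?_⟩
      simp only [descend, List.take_succ_cons, List.flatMap_cons, List.length_append] at hxr ⊢
      omega

end Cuts

/-! ### States of cuts and their transport along iterates. -/

section State

variable {α : Type*} [DecidableEq α] {k : ℕ}

/-- The second differences of the Parikh vectors of the prefixes ending at the cuts `p`. -/
def secondDiff (W : List α) (p : Fin (k + 1) → ℕ) (e : Fin (k - 1)) : α → ℤ :=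
  parikh (W.take (p ⟨e + 2, by omega⟩)) - 2 • parikh (W.take (p ⟨e + 1, by omega⟩))
    + parikh (W.take (p ⟨e, by omega⟩))

/-- The cuts `p` of `W` and the cuts `q` of `V` are followed by the same letters, are ordered in
the same way, and have the same second differences of Parikh vectors. -/
structure SameState (W : List α) (p : Fin (k + 1) → ℕ) (V : List α) (q : Fin (k + 1) → ℕ) :
    Prop where
  letter : ∀ i, W[p i]? = V[q i]?
  le_iff : ∀ i j, p i ≤ p j ↔ q i ≤ q j
  diff : ∀ e, secondDiff W p e = secondDiff V q e

theorem SameState.refl (W : List α) (p : Fin (k + 1) → ℕ) : SameState W p W p :=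
  ⟨fun _ => rfl, fun _ _ => Iff.rfl, fun _ => rfl⟩

theorem SameState.trans {W V U : List α} {p q r : Fin (k + 1) → ℕ} (h₁ : SameState W p V q)
    (h₂ : SameState V q U r) : SameState W p U r :=
  ⟨fun i => (h₁.letter i).trans (h₂.letter i), fun i j => (h₁.le_iff i j).trans (h₂.le_iff i j),
    fun e => (h₁.diff e).trans (h₂.diff e)⟩

/-- The contribution of the offsets `r` to the second differences of Parikh vectors. -/
def offsetDiff (g : α → List α) (o : Fin (k + 1) → Option α) (r : Fin (k + 1) → ℕ)
    (e : Fin (k - 1)) : α → ℤ :=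
  parikh ((block g (o ⟨e + 2, by omega⟩)).take (r ⟨e + 2, by omega⟩))
    - 2 • parikh ((block g (o ⟨e + 1, by omega⟩)).take (r ⟨e + 1, by omega⟩))
    + parikh ((block g (o ⟨e, by omega⟩)).take (r ⟨e, by omega⟩))

variable [Fintype α] {g : α → List α}

theorem secondDiff_flatMap {W : List α} {p r : Fin (k + 1) → ℕ}
    (hr : ∀ i, IsOffset g W[p i]? (r i)) (e : Fin (k - 1)) :
    secondDiff (W.flatMap g) (fun i => descend g W (p i) (r i)) e
      = (substMatrix g).mulVec (secondDiff W p e) + offsetDiff g (fun i => W[p i]?) r e := by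
  simp only [secondDiff, offsetDiff, take_flatMap_descend (hr _), parikh_append, parikh_flatMap,
    Matrix.mulVec_add, Matrix.mulVec_sub, Matrix.mulVec_smul]
  abel

/-- Equal letters after the cuts make the same offsets admissible in both words, and each component
of the new state depends only on the old state and the offsets. -/
theorem SameState.flatMap {W V : List α} {p q r : Fin (k + 1) → ℕ} (h : SameState W p V q)
    (hp : ∀ i, p i ≤ W.length) (hq : ∀ i, q i ≤ V.length)
    (hr : ∀ i, IsOffset g W[p i]? (r i)) :
    SameState (W.flatMap g) (fun i => descend g W (p i) (r i))
      (V.flatMap g) (fun i => descend g V (q i) (r i)) := by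
  have hr' : ∀ i, IsOffset g V[q i]? (r i) := fun i => h.letter i ▸ hr i
  refine ⟨fun i => ?_, fun i j => ?_, fun e => ?_⟩
  · rw [getElem?_flatMap_descend (hr i), getElem?_flatMap_descend (hr' i), h.letter]
  · rw [descend_le_descend_iff (hr i) (hr j) (hp i) (hp j),
      descend_le_descend_iff (hr' i) (hr' j) (hq i) (hq j), h.le_iff, h.le_iff]
  · rw [secondDiff_flatMap hr, secondDiff_flatMap hr', h.diff]
    congr 2
    exact funext h.letter

/-- The `l`-th iterate of the substitution `g` at the word `w`. -/
def iterSubst (g : α → List α) (l : ℕ) (w : List α) : List α := (fun u => u.flatMap g)^[l] w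

omit [DecidableEq α] [Fintype α] in
theorem iterSubst_succ (l : ℕ) (w : List α) :
    iterSubst g (l + 1) w = (iterSubst g l w).flatMap g :=
  Function.iterate_succ_apply' _ _ _

/-- The cuts `P l` of the words `iterSubst g l w`, for `l ≤ j`, descend from each other. -/
structure IsCutChain (g : α → List α) (w : List α) (j : ℕ) (P r : ℕ → Fin (k + 1) → ℕ) :
    Prop where
  le_length : ∀ l ≤ j, ∀ i, P l i ≤ (iterSubst g l w).length
  isOffset : ∀ l < j, ∀ i, IsOffset g (iterSubst g l w)[P l i]? (r l i)
  succ : ∀ l < j, P (l + 1) = fun i => descend g (iterSubst g l w) (P l i) (r l i)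

omit [DecidableEq α] [Fintype α] in
theorem exists_isCutChain (w : List α) (j : ℕ) {p : Fin (k + 1) → ℕ}
    (hp : ∀ i, p i ≤ (iterSubst g j w).length) :
    ∃ P r : ℕ → Fin (k + 1) → ℕ, IsCutChain g w j P r ∧ P j = p := by
  induction j generalizing p with
  | zero =>
    refine ⟨fun _ => p, fun _ _ => 0, ⟨?_, ?_, ?_⟩, rfl⟩
    · intro l hl i; obtain rfl : l = 0 := by omega
      exact hp i
    · intro l hl; omega
    · intro l hl; omega
  | succ j ih =>
    have h1 : ∀ i, ∃ p' r, p' ≤ (iterSubst g j w).length ∧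
        IsOffset g (iterSubst g j w)[p']? r ∧ p i = descend g (iterSubst g j w) p' r :=
      fun i => exists_descend_eq _ (by rw [← iterSubst_succ]; exact hp i)
    choose p' r' hp' hr' hpr using h1
    obtain ⟨P, r, hP, hPj⟩ := ih hp'
    refine ⟨Function.update P (j + 1) p, Function.update r j r', ⟨?_, ?_, ?_⟩, by simp⟩
    · intro l hl i
      by_cases h : l = j + 1
      · subst h; simpa using hp i
      · rw [Function.update_of_ne h]; exact hP.le_length l (by omega) i
    · intro l hl i
      rw [Function.update_of_ne (by omega)]
      by_cases h : l = j
      · subst h; simpa [hPj] using hr' i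
      · rw [Function.update_of_ne h]; exact hP.isOffset l (by omega) i
    · intro l hl
      rw [Function.update_of_ne (show l ≠ j + 1 by omega)]
      by_cases h : l = j
      · subst h; funext i; simpa [hPj] using hpr i
      · rw [Function.update_of_ne (by omega), Function.update_of_ne h]
        exact hP.succ l (by omega)

/-- The offsets recorded above level `l'` are replayed from level `l`. -/
theorem IsCutChain.exists_shift {w : List α} {j : ℕ} {P r : ℕ → Fin (k + 1) → ℕ}
    (hP : IsCutChain g w j P r) {l l' : ℕ} (hl : l ≤ j)
    (h : SameState (iterSubst g l' w) (P l') (iterSubst g l w) (P l)) (m : ℕ) (hm : l' + m ≤ j) :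
    ∃ q : Fin (k + 1) → ℕ, (∀ i, q i ≤ (iterSubst g (l + m) w).length) ∧
      SameState (iterSubst g (l' + m) w) (P (l' + m)) (iterSubst g (l + m) w) q := by
  induction m with
  | zero => exact ⟨P l, hP.le_length l hl, h⟩
  | succ m ih =>
    obtain ⟨q, hq, hs⟩ := ih (by omega)
    have hr := hP.isOffset (l' + m) (by omega)
    have h1 := hs.flatMap (hP.le_length _ (by omega)) hq hr
    rw [← iterSubst_succ, ← iterSubst_succ] at h1
    refine ⟨fun i => descend g (iterSubst g (l + m) w) (q i) (r (l' + m) i), fun i => ?_, ?_⟩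
    · rw [← add_assoc, iterSubst_succ]
      exact descend_le_length (hs.letter i ▸ hr i)
    · rw [← add_assoc, hP.succ (l' + m) (by omega)]
      exact h1

end State

/-! ### Bounded second differences and the pigeonhole argument. -/

section Bounds

/-- A discrete maximum principle. -/
theorem le_of_max_principle {β : Type*} [Fintype β] {f : ℕ → β → ℤ} {j : ℕ} {K R : ℤ}
    (hK : K ≤ 6 * R) (h0 : ∀ b, f 0 b ≤ R) (hj : ∀ b, f j b ≤ R)
    (h : ∀ l, 0 < l → l < j → ∀ b X, (∀ l ≤ j, ∀ b, f l b ≤ X) → 8 * f l b ≤ 2 * X + K) :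
    ∀ l ≤ j, ∀ b, f l b ≤ R := by
  intro l hl b
  have hne : (Finset.range (j + 1) ×ˢ (Finset.univ : Finset β)).Nonempty :=
    ⟨(l, b), by simp; omega⟩
  obtain ⟨⟨l₀, b₀⟩, hm, hmax⟩ := Finset.exists_max_image _ (fun x => f x.1 x.2) hne
  have hmax' : ∀ l ≤ j, ∀ b, f l b ≤ f l₀ b₀ := fun l hl b => hmax (l, b) (by simp; omega)
  refine (hmax' l hl b).trans ?_
  have hl₀ : l₀ ≤ j := by simp at hm; omega
  rcases Nat.eq_zero_or_pos l₀ with h1 | h1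
  · rw [h1]; exact h0 b₀
  · rcases hl₀.eq_or_lt with h2 | h2
    · rw [h2]; exact hj b₀
    · have := h l₀ h1 h2 b₀ _ hmax'
      linarith

variable {α : Type*} [DecidableEq α] {k : ℕ}

theorem abs_combination_le {x y z C : ℤ} (hx : 0 ≤ x) (hy : 0 ≤ y) (hz : 0 ≤ z) (hx' : x ≤ C)
    (hy' : y ≤ C) (hz' : z ≤ C) : |x - 2 * y + z| ≤ 2 * C := by
  rw [abs_le]; constructor <;> linarith

theorem abs_secondDiff_le (W : List α) (p : Fin (k + 1) → ℕ) (e : Fin (k - 1)) (a : α) :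
    |secondDiff W p e a| ≤ 2 * W.length := by
  simp only [secondDiff, Pi.add_apply, Pi.sub_apply, nsmul_eq_mul, Nat.cast_ofNat]
  exact abs_combination_le (parikh_nonneg _ _) (parikh_nonneg _ _) (parikh_nonneg _ _)
    (parikh_take_le _ _ _) (parikh_take_le _ _ _) (parikh_take_le _ _ _)

variable [Fintype α] {g : α → List α} {G : ℕ}

omit [DecidableEq α] in
theorem length_block_le (hG : ∑ c, (g c).length ≤ G) (o : Option α) :
    (block g o).length ≤ G := by
  cases o with
  | none => simp [block]
  | some c =>
    exact (Finset.single_le_sum (f := fun c => (g c).length) (fun _ _ => Nat.zero_le _)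
      (Finset.mem_univ c)).trans hG

theorem abs_offsetDiff_le (hG : ∑ c, (g c).length ≤ G) (o : Fin (k + 1) → Option α)
    (r : Fin (k + 1) → ℕ) (e : Fin (k - 1)) (a : α) : |offsetDiff g o r e a| ≤ 2 * G := by
  have h : ∀ i, parikh ((block g (o i)).take (r i)) a ≤ G := fun i =>
    (parikh_take_le _ _ _).trans (by exact_mod_cast length_block_le hG _)
  simp only [offsetDiff, Pi.add_apply, Pi.sub_apply, nsmul_eq_mul, Nat.cast_ofNat]
  exact abs_combination_le (parikh_nonneg _ _) (parikh_nonneg _ _) (parikh_nonneg _ _)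
    (h _) (h _) (h _)

theorem abs_substMatrix_mulVec_le (hG : ∑ c, (g c).length ≤ G) {x : α → ℤ} {X : ℤ}
    (hX0 : 0 ≤ X) (hX : ∀ a, |x a| ≤ X) (a : α) : |(substMatrix g).mulVec x a| ≤ G * X := by
  rw [Matrix.mulVec, dotProduct]
  refine (Finset.abs_sum_le_sum_abs _ _).trans ?_
  calc ∑ b, |substMatrix g a b * x b| ≤ ∑ b, ((g b).length : ℤ) * X := by
        refine Finset.sum_le_sum fun b _ => ?_
        rw [abs_mul]
        have h1 : |substMatrix g a b| ≤ (g b).length := by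
          rw [substMatrix, Matrix.of_apply, abs_of_nonneg (parikh_nonneg _ _)]
          exact parikh_le_length _ _
        exact mul_le_mul h1 (hX b) (abs_nonneg _) (by positivity)
    _ = (∑ b, (g b).length : ℕ) * X := by rw [← Finset.sum_mul]; push_cast; rfl
    _ ≤ G * X := by gcongr

omit [DecidableEq α] in
theorem abs_mulVec_le_of_small {Z : Matrix α α ℤ} {q : ℤ}
    (hZ : ∀ a b, (8 * Fintype.card α : ℕ) * |Z a b| ≤ q) {x : α → ℤ} {X : ℤ}
    (hX : ∀ a, |x a| ≤ X) (a : α) : 8 * |Z.mulVec x a| ≤ q * X := by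
  rw [Matrix.mulVec, dotProduct]
  have hc : 0 < Fintype.card α := Fintype.card_pos_iff.2 ⟨a⟩
  have h1 : (Fintype.card α : ℤ) * (8 * |∑ b, Z a b * x b|) ≤ Fintype.card α * (q * X) := by
    calc (Fintype.card α : ℤ) * (8 * |∑ b, Z a b * x b|)
        ≤ Fintype.card α * (8 * ∑ b, |Z a b * x b|) := by
          gcongr; exact Finset.abs_sum_le_sum_abs _ _
      _ = ∑ b, (8 * Fintype.card α : ℕ) * |Z a b| * |x b| := by
          rw [Finset.mul_sum, Finset.mul_sum]
          refine Finset.sum_congr rfl fun b _ => ?_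
          rw [abs_mul]; push_cast; ring
      _ ≤ ∑ b : α, q * X := by
          refine Finset.sum_le_sum fun b _ => ?_
          exact mul_le_mul (hZ a b) (hX b) (abs_nonneg _) ((by positivity : (0 : ℤ) ≤ _).trans (hZ a b))
      _ = Fintype.card α * (q * X) := by simp
  exact le_of_mul_le_mul_left h1 (by exact_mod_cast hc)

/-- A two-point boundary problem for `d (l + 1) = T d l + c l`: bounds at levels `0` and `j`
propagate to all levels between. -/
theorem IsCutChain.abs_secondDiff_le {w : List α} {j : ℕ} {P r : ℕ → Fin (k + 1) → ℕ}
    (hP : IsCutChain g w j P r) {q R : ℕ} (hq : 1 ≤ q) {Z : Matrix α α ℤ}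
    (hZ : Z - Z * (substMatrix g * substMatrix g) = (q : ℤ) • substMatrix g)
    (hZs : ∀ a b, (8 * Fintype.card α : ℕ) * |Z a b| ≤ q)
    (hG : ∑ c, (g c).length ≤ G) (hGR : 4 * G + G * G ≤ R) (hw : 2 * w.length ≤ R)
    (hj : ∀ e a, |secondDiff (iterSubst g j w) (P j) e a| ≤ R) :
    ∀ l ≤ j, ∀ e a, |secondDiff (iterSubst g l w) (P l) e a| ≤ R := by
  set T := substMatrix g with hT
  intro l hl e
  set d : ℕ → α → ℤ := fun l => secondDiff (iterSubst g l w) (P l) e with hd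
  set c : ℕ → α → ℤ := fun l => offsetDiff g (fun i => (iterSubst g l w)[P l i]?) (r l) e with hc
  have hrec : ∀ l < j, d (l + 1) = T.mulVec (d l) + c l := by
    intro l hl
    simp only [hd, hc]
    rw [iterSubst_succ, hP.succ l hl, secondDiff_flatMap (hP.isOffset l hl)]
  have hcb : ∀ l a, |c l a| ≤ 2 * G := fun l a => abs_offsetDiff_le hG _ _ _ _
  -- In `K`, the part `16 * G` comes from `8 * |c l a|`, and `2 * G + 2 * G * G` from the bound on
  -- `y` below.
  refine le_of_max_principle (f := fun l a => |d l a|) (K := 18 * G + 2 * G * G) ?_ ?_ (hj e) ?_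
    l hl
  · have : ((4 * G + G * G : ℕ) : ℤ) ≤ R := by exact_mod_cast hGR
    push_cast at this
    nlinarith [(Nat.cast_nonneg G : (0 : ℤ) ≤ G)]
  · intro a
    refine (AbelianTemplates.abs_secondDiff_le _ _ _ _).trans ?_
    exact_mod_cast hw
  · intro l hl0 hlj a X hX
    obtain ⟨l, rfl⟩ : ∃ l', l = l' + 1 := ⟨l - 1, by omega⟩
    have hX0 : 0 ≤ X := (abs_nonneg _).trans (hX 0 (by omega) a)
    have h1 := hrec l (by omega)
    have h2 := hrec (l + 1) hlj
    -- `y` is `(1 - T²) d l`, rewritten through the two neighbouring levels; since `Z (1 - T²) = q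
    -- T`, applying `Z` gives `q T d l = q (d (l + 1) - c l)`.
    set y : α → ℤ := d l - (d (l + 1 + 1) - c (l + 1) - T.mulVec (c l)) with hy
    have h3 : (q : ℤ) • (d (l + 1) - c l) = Z.mulVec y := by
      have h4 : y = d l - T.mulVec (T.mulVec (d l)) := by
        rw [hy, h2, h1, Matrix.mulVec_add]; abel
      rw [h4, Matrix.mulVec_sub, Matrix.mulVec_mulVec, Matrix.mulVec_mulVec,
        ← Matrix.sub_mulVec, Matrix.mul_assoc, hZ, Matrix.smul_mulVec, h1, add_sub_cancel_right]
    have hyb : ∀ b, |y b| ≤ 2 * X + 2 * G + G * (2 * G) := by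
      intro b
      have e1 := abs_le.1 (hX l (by omega) b)
      have e2 := abs_le.1 (hX (l + 1 + 1) (by omega) b)
      have e3 := abs_le.1 (hcb (l + 1) b)
      have e4 := abs_le.1 (abs_substMatrix_mulVec_le hG (by positivity) (hcb l) b)
      simp only [hy, Pi.sub_apply]
      rw [abs_le]
      constructor <;> linarith
    have h5 := abs_mulVec_le_of_small hZs hyb a
    rw [← h3, Pi.smul_apply, smul_eq_mul, abs_mul, Nat.abs_cast] at h5
    have h6 : 8 * |(d (l + 1) - c l) a| ≤ 2 * X + 2 * G + G * (2 * G) := by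
      refine le_of_mul_le_mul_left ?_ (show (0 : ℤ) < q by exact_mod_cast hq)
      linarith
    have h7 := hcb l a
    have h8 : |d (l + 1) a| ≤ |(d (l + 1) - c l) a| + |c l a| := by
      have := abs_add_le ((d (l + 1) - c l) a) (c l a)
      simpa using this
    linarith

/-- A bound on the number of states of cuts with second differences bounded by `R`. -/
def numStates (n k R : ℕ) : ℕ :=
  -- The factors count the letters after the cuts (or the end of the word), the comparison tables,
  -- and the vectors with entries in `[-R, R]`.
  (n + 1) ^ (k + 1) * ((2 ^ (k + 1)) ^ (k + 1) * ((2 * R + 1) ^ n) ^ (k - 1))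

theorem exists_sameState_lt_numStates {w : List α} {q R : ℕ} (hq : 1 ≤ q) {Z : Matrix α α ℤ}
    (hZ : Z - Z * (substMatrix g * substMatrix g) = (q : ℤ) • substMatrix g)
    (hZs : ∀ a b, (8 * Fintype.card α : ℕ) * |Z a b| ≤ q)
    (hG : ∑ c, (g c).length ≤ G) (hGR : 4 * G + G * G ≤ R) (hw : 2 * w.length ≤ R)
    (j : ℕ) (p : Fin (k + 1) → ℕ) (hp : ∀ i, p i ≤ (iterSubst g j w).length)
    (hj : ∀ e a, |secondDiff (iterSubst g j w) p e a| ≤ R) :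
    ∃ j' < numStates (Fintype.card α) k R, ∃ p' : Fin (k + 1) → ℕ,
      (∀ i, p' i ≤ (iterSubst g j' w).length) ∧
      SameState (iterSubst g j w) p (iterSubst g j' w) p' := by
  induction j using Nat.strong_induction_on generalizing p with
  | _ j ih =>
    by_cases hlt : j < numStates (Fintype.card α) k R
    · exact ⟨j, hlt, p, hp, SameState.refl _ _⟩
    obtain ⟨P, r, hP, rfl⟩ := exists_isCutChain w j hp
    have hb := hP.abs_secondDiff_le hq hZ hZs hG hGR hw hj
    let S := (Fin (k + 1) → Option α) × (Fin (k + 1) → Fin (k + 1) → Bool) ×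
      (Fin (k - 1) → α → Finset.Icc (-(R : ℤ)) R)
    let F : Fin (j + 1) → S := fun l =>
      (fun i => (iterSubst g l w)[P l i]?, fun i i' => decide (P l i ≤ P l i'),
        fun e a => ⟨secondDiff (iterSubst g l w) (P l) e a,
          Finset.mem_Icc.2 (abs_le.1 (hb l (by omega) e a))⟩)
    have hcard : Fintype.card S = numStates (Fintype.card α) k R := by
      simp only [S, numStates, Fintype.card_prod, Fintype.card_fun, Fintype.card_fin,
        Fintype.card_option, Fintype.card_bool, Fintype.card_coe, Int.card_Icc]
      congr 4
      omega
    obtain ⟨l, l', hne, hF⟩ := Fintype.exists_ne_map_eq_of_card_lt F (by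
      rw [hcard, Fintype.card_fin]; omega)
    wlog hll : l < l' generalizing l l'
    · exact this l' l hne.symm hF.symm (lt_of_le_of_ne (not_lt.1 hll) hne.symm)
    have hss : SameState (iterSubst g l' w) (P l') (iterSubst g l w) (P l) := by
      refine ⟨fun i => ?_, fun i i' => ?_, fun e => ?_⟩
      · exact (congrFun (congrArg Prod.fst hF) i).symm
      · have := congrFun (congrFun (congrArg (fun x => x.2.1) hF) i) i'
        exact decide_eq_decide.1 this.symm
      · funext a
        have := congrArg Subtype.val (congrFun (congrFun (congrArg (fun x => x.2.2) hF) e) a)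
        exact this.symm
    have hl' : (l' : ℕ) ≤ j := by omega
    -- Excising the levels from `l` to `l'` lowers `j` and keeps the top state, hence also its bound
    -- `R`, so the induction hypothesis applies.
    obtain ⟨p', hp', hs⟩ := hP.exists_shift (by omega) hss (j - l') (by omega)
    rw [Nat.add_sub_cancel' hl'] at hs
    have hll' : (l : ℕ) < l' := hll
    obtain ⟨j', hj', p'', hp'', hs'⟩ := ih (l + (j - l')) (by omega) p' hp' (fun e a => by
      rw [← hs.diff e]; exact hj e a)
    exact ⟨j', hj', p'', hp'', hs.trans hs'⟩

end Bounds
end AbelianTemplates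
namespace AbelianTemplates

/-! ### Realizations of templates as systems of cuts. -/

section Realization

variable {α : Type*} [DecidableEq α] {k : ℕ}

/-- Cutting the word `W` at the positions `p` exhibits a factor of `W` that realizes `t`. -/
structure IsRealization (W : List α) (t : Template α k) (p : Fin (k + 1) → ℕ) : Prop where
  le_length : ∀ i, p i ≤ W.length
  mono : ∀ i : Fin k, p i.castSucc ≤ p i.succ
  letter : ∀ i a, t.letters i = some a → W[p i]? = some a
  lt : ∀ i : Fin k, t.letters i.castSucc ≠ none → ¬ p i.succ ≤ p i.castSucc
  diff : ∀ e : Fin (k - 1), secondDiff W p e = t.diffs e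
    + parikh (t.letters ⟨e + 1, by omega⟩).toList - parikh (t.letters ⟨e, by omega⟩).toList

theorem IsRealization.of_sameState {W V : List α} {t : Template α k} {p q : Fin (k + 1) → ℕ}
    (h : IsRealization W t p) (hs : SameState W p V q) (hq : ∀ i, q i ≤ V.length) :
    IsRealization V t q where
  le_length := hq
  mono i := (hs.le_iff _ _).1 (h.mono i)
  letter i a ha := (hs.letter i).symm.trans (h.letter i a ha)
  lt i hi := fun hle => h.lt i hi ((hs.le_iff _ _).2 hle)
  diff e := (hs.diff e).symm.trans (h.diff e)

theorem secondDiff_of_chain {W : List α} {a : Fin (k + 1) → List α} {v : Fin k → List α}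
    {p : Fin (k + 1) → ℕ}
    (h : ∀ i : Fin k, W.take (p i.succ) = W.take (p i.castSucc) ++ (a i.castSucc ++ v i))
    (e : Fin (k - 1)) :
    secondDiff W p e = parikh (v ⟨e + 1, by omega⟩) - parikh (v ⟨e, by omega⟩)
      + parikh (a ⟨e + 1, by omega⟩) - parikh (a ⟨e, by omega⟩) := by
  have h1 := congrArg parikh (h ⟨e, by omega⟩)
  have h2 := congrArg parikh (h ⟨e + 1, by omega⟩)
  simp only [parikh_append, Fin.succ_mk, Fin.castSucc_mk] at h1 h2
  rw [secondDiff, h2, h1]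
  abel

omit [DecidableEq α] in
theorem take_add_length_toList {W : List α} {o : Option α} {p : ℕ}
    (h : ∀ a, o = some a → W[p]? = some a) :
    W.take (p + o.toList.length) = W.take p ++ o.toList := by
  cases o with
  | none => simp
  | some a => simp [List.take_add_one, h a rfl]

omit [DecidableEq α] in
theorem take_eq_append_flatten_take {W : List α} {x : Fin k → List α} {p : Fin (k + 1) → ℕ}
    (h : ∀ i : Fin k, W.take (p i.succ) = W.take (p i.castSucc) ++ x i) (m : ℕ) (hm : m < k + 1) :
    W.take (p ⟨m, hm⟩) = W.take (p 0) ++ ((List.ofFn x).take m).flatten := by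
  induction m with
  | zero => simp
  | succ m ih =>
    have h1 := h ⟨m, by omega⟩
    simp only [Fin.succ_mk, Fin.castSucc_mk] at h1
    rw [h1, ih, List.take_add_one, List.flatten_append, List.append_assoc]
    congr 2
    rw [List.getElem?_eq_getElem (by simp; omega)]
    simp

theorem exists_infix_realizes_iff {W : List α} {t : Template α k} :
    (∃ u, u <:+: W ∧ Realizes u t) ↔ ∃ p, IsRealization W t p := by
  constructor
  · rintro ⟨u, ⟨s, e, rfl⟩, v, rfl, hd⟩
    set x : Fin k → List α := fun i => (t.letters i.castSucc).toList ++ v i with hx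
    -- `Q i` is the prefix of `W` ending just before the entry `t.letters i`; its length is the cut.
    set Q : ℕ → List α := fun i => s ++ ((List.ofFn x).take i).flatten with hQ
    have hQs : ∀ i : Fin k, Q (i + 1) = Q i ++ x i := by
      intro i
      simp only [hQ]
      rw [List.take_add_one, List.flatten_append, ← List.append_assoc]
      congr 1
      rw [List.getElem?_eq_getElem (by simp)]
      simp
    have hQk : Q k = s ++ (List.ofFn x).flatten := by
      simp only [hQ]
      rw [List.take_of_length_le (by simp)]
    set W := s ++ ((List.ofFn x).flatten ++ (t.letters (Fin.last k)).toList) ++ e with hW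
    have hWQ : W = Q k ++ (t.letters (Fin.last k)).toList ++ e := by
      rw [hW, hQk]; simp
    have hpre : ∀ i ≤ k, Q i <+: Q k := by
      intro i hi
      simp only [hQ]
      rw [List.prefix_append_right_inj]
      have : (List.ofFn x).take i <+: (List.ofFn x).take k := List.take_prefix_take_left hi
      obtain ⟨y, hy⟩ := this
      rw [← hy, List.flatten_append]
      exact List.prefix_append _ _
    have htake : ∀ i ≤ k, W.take (Q i).length = Q i := by
      intro i hi
      obtain ⟨y, hy⟩ := hpre i hi
      rw [hWQ, ← hy, List.append_assoc, List.append_assoc, List.take_left']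
      rfl
    have hchain : ∀ i : Fin k, W.take (Q (i.succ : Fin (k + 1))).length
        = W.take (Q (i.castSucc : Fin (k + 1))).length ++ x i := by
      intro i
      rw [htake _ (by simp), htake _ (by simp), Fin.val_succ, Fin.val_castSucc, hQs]
    have hlet : ∀ (i : Fin (k + 1)) a, t.letters i = some a → W[(Q i).length]? = some a := by
      intro i a ha
      induction i using Fin.lastCases with
      | last => rw [hWQ, ha]; simp
      | cast i =>
        have h1 : Q (i + 1) <+: W := by
          rw [← htake (i + 1) (by omega)]; exact List.take_prefix _ _
        obtain ⟨y, hy⟩ := h1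
        rw [← hy, hQs]
        simp [hx, ha]
    refine ⟨fun i => (Q i).length, ?_, ?_, hlet, ?_, ?_⟩
    · intro i
      rw [← htake i (by omega), List.length_take]
      exact min_le_right _ _
    · intro i
      simp [hQs]
    · intro i hi
      obtain ⟨a, ha⟩ := Option.ne_none_iff_exists'.1 hi
      simp [hQs, hx, ha]
    · intro e
      rw [secondDiff_of_chain (a := fun i => (t.letters i).toList) hchain e, hd e]
  · rintro ⟨p, h⟩
    set v : Fin k → List α := fun i =>
      (W.take (p i.succ)).drop (p i.castSucc + (t.letters i.castSucc).toList.length) with hv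
    have hchain : ∀ i : Fin k, W.take (p i.succ)
        = W.take (p i.castSucc) ++ ((t.letters i.castSucc).toList ++ v i) := by
      intro i
      have hle : p i.castSucc + (t.letters i.castSucc).toList.length ≤ p i.succ := by
        have h1 := h.mono i
        have h2 := h.lt i
        cases ho : t.letters i.castSucc with
        | none => simpa using h1
        | some a =>
          have := h2 (by simp [ho])
          simp only [Option.toList_some, List.length_singleton]
          omega
      rw [← List.append_assoc, ← take_add_length_toList (h.letter i.castSucc)]
      conv_lhs => rw [← List.take_append_drop
        (p i.castSucc + (t.letters i.castSucc).toList.length) (W.take (p i.succ))]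
      rw [List.take_take, min_eq_left hle]
    have hfl := take_eq_append_flatten_take hchain k (Nat.lt_succ_self k)
    rw [List.take_of_length_le (l := List.ofFn _) (by simp)] at hfl
    refine ⟨_, ⟨W.take (p 0), W.drop (p (Fin.last k) + (t.letters (Fin.last k)).toList.length), ?_⟩,
      v, rfl, fun e => ?_⟩
    · rw [← List.append_assoc, ← hfl]
      have := take_add_length_toList (h.letter (Fin.last k))
      rw [show (⟨k, Nat.lt_succ_self k⟩ : Fin (k + 1)) = Fin.last k from rfl, ← this,
        List.take_append_drop]
    · have h1 := secondDiff_of_chain (a := fun i => (t.letters i).toList) hchain e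
      rw [h.diff e] at h1
      rw [add_sub_assoc, add_sub_assoc] at h1
      exact (add_right_cancel h1).symm

end Realization

/-! ### Reduction to a bounded power of the morphism. -/

section Bounded

variable {α : Type*} [DecidableEq α] [Fintype α] {k : ℕ}

/-- The word substituted for a letter by the morphism `h`. -/
def images (h : FreeMonoid α →* FreeMonoid α) (a : α) : List α := (h (FreeMonoid.of a)).toList

omit [DecidableEq α] [Fintype α] in
theorem toList_map_eq_flatMap (h : FreeMonoid α →* FreeMonoid α) (w : FreeMonoid α) :
    (h w).toList = w.toList.flatMap (images h) := by
  induction w using FreeMonoid.inductionOn' with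
  | one => simp
  | of_mul a w ih => rw [map_mul, FreeMonoid.toList_mul, ih]; simp [images]

omit [DecidableEq α] [Fintype α] in
theorem iterImage_eq_iterSubst (h : FreeMonoid α →* FreeMonoid α) (i : ℕ) (a : α) :
    iterImage h i a = iterSubst (images h) i [a] := by
  induction i with
  | zero => rfl
  | succ i ih =>
    rw [iterSubst_succ, ← ih, iterImage, Function.iterate_succ_apply', toList_map_eq_flatMap]
    rfl

omit [DecidableEq α] [Fintype α] in
theorem iterSubst_append (g : α → List α) (i : ℕ) (u v : List α) :
    iterSubst g i (u ++ v) = iterSubst g i u ++ iterSubst g i v := by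
  induction i with
  | zero => rfl
  | succ i ih => rw [iterSubst_succ, iterSubst_succ, iterSubst_succ, ih, List.flatMap_append]

omit [DecidableEq α] [Fintype α] in
theorem iterSubst_eq_flatMap (g : α → List α) (N : ℕ) (w : List α) :
    iterSubst g N w = w.flatMap fun a => iterSubst g N [a] := by
  induction w with
  | nil =>
    induction N with
    | zero => rfl
    | succ N ih => rw [iterSubst_succ, ih]; rfl
  | cons a w ih => rw [← List.singleton_append, iterSubst_append, ih]; simp

omit [DecidableEq α] [Fintype α] in
theorem iterSubst_add (g : α → List α) (i j : ℕ) (w : List α) :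
    iterSubst g (i + j) w = iterSubst g i (iterSubst g j w) :=
  Function.iterate_add_apply _ _ _ _

omit [DecidableEq α] [Fintype α] in
theorem iterSubst_mul_add (g : α → List α) (N j r : ℕ) (w : List α) :
    iterSubst g (N * j + r) w
      = iterSubst (fun a => iterSubst g N [a]) j (iterSubst g r w) := by
  induction j with
  | zero => simp [iterSubst]
  | succ j ih =>
    rw [iterSubst_succ, ← ih, ← iterSubst_eq_flatMap, ← iterSubst_add]
    congr 1
    ring

theorem parikh_injective_mulVec {A B : Matrix α α ℤ} (h : ∀ w : List α,
    A.mulVec (parikh w) = B.mulVec (parikh w)) : A = B := by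
  ext a b
  have h1 := congrFun (h [b]) a
  simpa [parikh_singleton] using h1

theorem substMatrix_iterSubst (g : α → List α) (N : ℕ) :
    substMatrix (fun a => iterSubst g N [a]) = substMatrix g ^ N := by
  refine parikh_injective_mulVec fun w => ?_
  rw [← parikh_flatMap, ← iterSubst_eq_flatMap]
  induction N with
  | zero => simp [iterSubst]
  | succ N ih => rw [iterSubst_succ, parikh_flatMap, ih, Matrix.mulVec_mulVec, pow_succ']

/-- If a hyperbolicity certificate and a bound `R` for the sizes involved are given, a realizable
template is realized by a factor of the image of a letter under a bounded power of `h`. -/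
theorem realizable_iff_exists_isRealization {h : FreeMonoid α →* FreeMonoid α} {N q R : ℕ}
    {Z : Matrix α α ℤ} (hN : 1 ≤ N) (hq : 1 ≤ q)
    (hZ : Z - Z * substMatrix (images h) ^ (2 * N) = (q : ℤ) • substMatrix (images h) ^ N)
    (hZs : ∀ a b, (8 * Fintype.card α : ℕ) * |Z a b| ≤ q) {G : ℕ}
    (hG : ∑ c, (iterSubst (images h) N [c]).length ≤ G) (hGR : 4 * G + G * G ≤ R)
    (hR : ∀ r ≤ N, ∀ a, 2 * (iterSubst (images h) r [a]).length ≤ R)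
    (t : Template α k) (ht : ∀ e a, |t.diffs e a| + 1 ≤ R) :
    Realizable h t ↔ ∃ i < N * numStates (Fintype.card α) k R + 1, 1 ≤ i ∧
      ∃ a p, IsRealization (iterSubst (images h) i [a]) t p := by
  constructor
  · rintro ⟨u, ⟨i, hi, a, hu⟩, hut⟩
    obtain ⟨p, hp⟩ := exists_infix_realizes_iff.1 ⟨u, hu, hut⟩
    rw [iterImage_eq_iterSubst] at hp
    -- Remainders run over `1, …, N` so that the exponent stays positive even if `j` is reduced to
    -- `0`. The chain starts from the word `h^r(a)` and iterates `h^N`.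
    obtain ⟨j, r, rfl, hr1, hrN⟩ : ∃ j r, i = N * j + r ∧ 1 ≤ r ∧ r ≤ N := by
      refine ⟨(i - 1) / N, (i - 1) % N + 1, ?_, by omega, Nat.mod_lt _ (by omega)⟩
      have := Nat.div_add_mod (i - 1) N
      omega
    rw [iterSubst_mul_add] at hp
    have hd : ∀ e b, |secondDiff (iterSubst (fun a => iterSubst (images h) N [a]) j
        (iterSubst (images h) r [a])) p e b| ≤ R := by
      intro e b
      rw [hp.diff e]
      have h0 : ∀ o : Option α, 0 ≤ parikh o.toList b ∧ parikh o.toList b ≤ 1 := fun o =>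
        ⟨parikh_nonneg _ _, (parikh_le_length _ _).trans (by cases o <;> simp)⟩
      have h1 := h0 (t.letters ⟨e + 1, by omega⟩)
      have h2 := h0 (t.letters ⟨e, by omega⟩)
      have h3 := abs_le.1 (le_sub_iff_add_le.2 (ht e b))
      simp only [Pi.add_apply, Pi.sub_apply]
      rw [abs_le]
      constructor <;> linarith
    obtain ⟨j', hj', p', hp', hs⟩ := exists_sameState_lt_numStates hq
      (by rw [substMatrix_iterSubst, ← pow_add, ← two_mul]; exact hZ) hZs hG hGR (hR r hrN a)
      j p hp.le_length hd
    refine ⟨N * j' + r, ?_, by omega, a, p', ?_⟩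
    · have : N * (j' + 1) ≤ N * numStates (Fintype.card α) k R := Nat.mul_le_mul_left _ hj'
      rw [Nat.mul_succ] at this
      omega
    · rw [iterSubst_mul_add]
      exact hp.of_sameState hs hp'
  · rintro ⟨i, -, hi, a, p, hp⟩
    rw [← iterImage_eq_iterSubst] at hp
    obtain ⟨u, hu, hut⟩ := exists_infix_realizes_iff.2 ⟨p, hp⟩
    exact ⟨u, ⟨i, hi, a, hu⟩, hut⟩

end Bounded
end AbelianTemplates
namespace AbelianTemplates

/-! ### Closure properties of primitive recursive functions and predicates. -/

section PrimrecLemmas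

variable {γ : Type*} [Primcodable γ]

theorem primrecPred_forall_lt {f : γ → ℕ} {P : γ → ℕ → Prop} (hf : Primrec f)
    (hP : PrimrecPred fun x : γ × ℕ => P x.1 x.2) : PrimrecPred fun c => ∀ i < f c, P c i := by
  have h : PrimrecRel fun (i : ℕ) (c : γ) => P c i := hP.comp (Primrec.snd.pair Primrec.fst)
  exact (h.forall_mem_list.comp (Primrec.list_range.comp hf) Primrec.id).of_eq (by simp)

theorem primrecPred_exists_mem {β : Type*} [Primcodable β] {f : γ → List β} {P : γ → β → Prop}
    (hf : Primrec f) (hP : PrimrecPred fun x : γ × β => P x.1 x.2) :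
    PrimrecPred fun c => ∃ i ∈ f c, P c i := by
  have h : PrimrecRel fun (i : β) (c : γ) => P c i := hP.comp (Primrec.snd.pair Primrec.fst)
  exact h.exists_mem_list.comp hf Primrec.id

theorem primrecPred_exists_lt {f : γ → ℕ} {P : γ → ℕ → Prop} (hf : Primrec f)
    (hP : PrimrecPred fun x : γ × ℕ => P x.1 x.2) : PrimrecPred fun c => ∃ i < f c, P c i :=
  (primrecPred_exists_mem (Primrec.list_range.comp hf) hP).of_eq (by simp)

theorem primrecPred_and {p q : γ → Prop} (hp : PrimrecPred p) (hq : PrimrecPred q) :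
    PrimrecPred fun c => p c ∧ q c := hp.and hq

theorem primrecPred_or {p q : γ → Prop} (hp : PrimrecPred p) (hq : PrimrecPred q) :
    PrimrecPred fun c => p c ∨ q c := hp.or hq

theorem primrecPred_eq {β : Type*} [Primcodable β] {f g : γ → β} (hf : Primrec f)
    (hg : Primrec g) : PrimrecPred fun c => f c = g c := by
  classical exact Primrec.eq.comp hf hg

theorem primrecPred_le {f g : γ → ℕ} (hf : Primrec f) (hg : Primrec g) :
    PrimrecPred fun c => f c ≤ g c := Primrec.nat_le.comp hf hg

theorem primrecPred_lt {f g : γ → ℕ} (hf : Primrec f) (hg : Primrec g) :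
    PrimrecPred fun c => f c < g c := Primrec.nat_lt.comp hf hg

theorem primrec_self : Primrec fun c : γ => c := Primrec.id

theorem primrec_fst {β δ : Type*} [Primcodable β] [Primcodable δ] {f : γ → β × δ}
    (hf : Primrec f) : Primrec fun c => (f c).1 := Primrec.fst.comp hf

theorem primrec_snd {β δ : Type*} [Primcodable β] [Primcodable δ] {f : γ → β × δ}
    (hf : Primrec f) : Primrec fun c => (f c).2 := Primrec.snd.comp hf

theorem primrec_add {f g : γ → ℕ} (hf : Primrec f) (hg : Primrec g) :
    Primrec fun c => f c + g c := Primrec.nat_add.comp hf hg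

theorem primrec_sub {f g : γ → ℕ} (hf : Primrec f) (hg : Primrec g) :
    Primrec fun c => f c - g c := Primrec.nat_sub.comp hf hg

theorem primrec_mul {f g : γ → ℕ} (hf : Primrec f) (hg : Primrec g) :
    Primrec fun c => f c * g c := Primrec.nat_mul.comp hf hg

theorem primrec_pow {f g : γ → ℕ} (hf : Primrec f) (hg : Primrec g) :
    Primrec fun c => f c ^ g c :=
  (Primrec₂.unpaired'.1 Nat.Primrec.pow).comp hf hg

theorem primrec_length {β : Type*} [Primcodable β] {f : γ → List β} (hf : Primrec f) :
    Primrec fun c => (f c).length := Primrec.list_length.comp hf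

theorem primrec_range {f : γ → ℕ} (hf : Primrec f) : Primrec fun c => List.range (f c) :=
  Primrec.list_range.comp hf

theorem primrec_getD {β : Type*} [Primcodable β] {f : γ → List β} {g : γ → ℕ} {d : β}
    (hf : Primrec f) (hg : Primrec g) : Primrec fun c => (f c).getD (g c) d :=
  (Primrec.list_getD d).comp hf hg

theorem primrec_getElem? {β : Type*} [Primcodable β] {f : γ → List β} {g : γ → ℕ}
    (hf : Primrec f) (hg : Primrec g) : Primrec fun c => (f c)[g c]? :=
  Primrec.list_getElem?.comp hf hg

theorem primrec_take {β : Type*} [Primcodable β] {f : γ → List β} {g : γ → ℕ}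
    (hf : Primrec f) (hg : Primrec g) : Primrec fun c => (f c).take (g c) :=
  Primrec.list_take.comp hg hf

theorem primrec_singleton {β : Type*} [Primcodable β] {f : γ → β} (hf : Primrec f) :
    Primrec fun c => [f c] := Primrec.list_cons.comp hf (Primrec.const [])

theorem primrec_toList {β : Type*} [Primcodable β] {f : γ → Option β} (hf : Primrec f) :
    Primrec fun c => (f c).toList := Primrec.optionToList.comp hf

theorem primrec_count {f : γ → List ℕ} {g : γ → ℕ} (hf : Primrec f) (hg : Primrec g) :
    Primrec fun c => (f c).count (g c) := by
  have h : PrimrecRel fun a b : ℕ => a = b := Primrec.eq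
  refine (Primrec.list_length.comp (h.listFilter.comp hf hg)).of_eq fun c => ?_
  rw [List.count_eq_length_filter]
  rfl

theorem int_encode_natCast (m : ℕ) : Encodable.encode (m : ℤ) = 2 * m := rfl

theorem int_encode_negSucc (m : ℕ) : Encodable.encode (Int.negSucc m) = 2 * m + 1 := rfl

/-- Nonnegative integers have even codes and negative ones odd codes, so parity and halving of the
code suffice. -/
theorem primrec_toNat {f : γ → ℤ} (hf : Primrec f) : Primrec fun c => (f c).toNat := by
  have h : Primrec fun m : ℕ => if m % 2 = 0 then m / 2 else 0 :=
    Primrec.ite (primrecPred_eq (Primrec.nat_mod.comp Primrec.id (Primrec.const 2))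
      (Primrec.const 0)) (Primrec.nat_div.comp Primrec.id (Primrec.const 2)) (Primrec.const 0)
  refine (h.comp (Primrec.encode.comp hf)).of_eq fun c => ?_
  cases f c with
  | ofNat m => rw [Int.ofNat_eq_natCast, int_encode_natCast]; simp
  | negSucc m => rw [int_encode_negSucc, if_neg (by omega)]; rfl

theorem primrec_neg_toNat {f : γ → ℤ} (hf : Primrec f) : Primrec fun c => (-f c).toNat := by
  have h : Primrec fun m : ℕ => if m % 2 = 0 then 0 else m / 2 + 1 :=
    Primrec.ite (primrecPred_eq (Primrec.nat_mod.comp Primrec.id (Primrec.const 2))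
      (Primrec.const 0)) (Primrec.const 0)
      (primrec_add (Primrec.nat_div.comp Primrec.id (Primrec.const 2)) (Primrec.const 1))
  refine (h.comp (Primrec.encode.comp hf)).of_eq fun c => ?_
  cases f c with
  | ofNat m => rw [Int.ofNat_eq_natCast, int_encode_natCast]; simp
  | negSucc m =>
    rw [int_encode_negSucc, if_neg (by omega), Int.neg_negSucc]
    simp only [Int.toNat_natCast]
    omega

end PrimrecLemmas

/-! ### The certificate search and its computability. -/

section Algorithm

/-- The substitution given by the list of the images of the letters. -/
def substList (H : List (List ℕ)) (w : List ℕ) : List ℕ := w.flatMap fun a => H.getD a []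

/-- The `i`-th iterate of the substitution given by the list of the images of the letters. -/
def iterList (H : List (List ℕ)) (i : ℕ) (w : List ℕ) : List ℕ := (substList H)^[i] w

/-- The lists of length `m` with entries in `X`. -/
def tuples (X : List ℕ) (m : ℕ) : List (List ℕ) :=
  (fun S : List (List ℕ) => X.flatMap fun x => S.map fun l => x :: l)^[m] [[]]

theorem mem_tuples {X : List ℕ} {m : ℕ} {l : List ℕ} :
    l ∈ tuples X m ↔ l.length = m ∧ ∀ x ∈ l, x ∈ X := by
  induction m generalizing l with
  | zero => simp +contextual [tuples]
  | succ m ih =>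
    have h : tuples X (m + 1) = X.flatMap fun x => (tuples X m).map fun l => x :: l :=
      Function.iterate_succ_apply' _ _ _
    rw [h]
    cases l with
    | nil => simp
    | cons y l => simp [ih]; tauto

/-- The list `p` cuts the word `W` as required for a realization of the encoded template. -/
def CutOK (x : Code) (W p : List ℕ) : Prop :=
  (∀ i < x.2.1.length - 1, p.getD i 0 ≤ p.getD (i + 1) 0) ∧
  (∀ i < x.2.1.length, x.2.1.getD i none = none ∨ W[p.getD i 0]? = x.2.1.getD i none) ∧
  (∀ i < x.2.1.length - 1, x.2.1.getD i none = none ∨ p.getD i 0 < p.getD (i + 1) 0) ∧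
  -- The list of entries has length `k + 1`, so `e` ranges over `k - 1` values. Negative terms are
  -- moved across the equation to stay in `ℕ`.
  ∀ e < x.2.1.length - 2, ∀ a < x.1.length,
    (W.take (p.getD (e + 2) 0)).count a + (W.take (p.getD e 0)).count a
        + (-((x.2.2.getD e []).getD a 0)).toNat + (x.2.1.getD e none).toList.count a
      = 2 * (W.take (p.getD (e + 1) 0)).count a + ((x.2.2.getD e []).getD a 0).toNat
        + (x.2.1.getD (e + 1) none).toList.count a

/-- The certificates `(N, q, P, Q, R)` searched for by the algorithm: the morphisms `P` and `Q`
stand for the integer matrix `M_P - M_Q`. -/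
abbrev Cert : Type := ℕ × ℕ × List (List ℕ) × List (List ℕ) × ℕ

/-- The condition on the matrix of a certificate. -/
def HyperbolicOK (H : List (List ℕ)) (c : Cert) : Prop :=
  1 ≤ c.1 ∧ 1 ≤ c.2.1 ∧ ∀ a < H.length, ∀ b < H.length,
    c.2.1 * (iterList H c.1 [a]).count b
        + (substList c.2.2.1 (iterList H (2 * c.1) [a])).count b
        + (c.2.2.2.1.getD a []).count b
      = (c.2.2.1.getD a []).count b
        + (substList c.2.2.2.1 (iterList H (2 * c.1) [a])).count b ∧
    8 * H.length * (c.2.2.1.getD a []).count b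
      ≤ c.2.1 + 8 * H.length * (c.2.2.2.1.getD a []).count b ∧
    8 * H.length * (c.2.2.2.1.getD a []).count b
      ≤ c.2.1 + 8 * H.length * (c.2.2.1.getD a []).count b

/-- The condition on the bound of a certificate. -/
def BoundOK (x : Code) (c : Cert) : Prop :=
  4 * (iterList x.1 c.1 (List.range x.1.length)).length
      + (iterList x.1 c.1 (List.range x.1.length)).length
        * (iterList x.1 c.1 (List.range x.1.length)).length ≤ c.2.2.2.2 ∧
  (∀ r < c.1 + 1, ∀ a < x.1.length, 2 * (iterList x.1 r [a]).length ≤ c.2.2.2.2) ∧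
  ∀ e < x.2.1.length - 2, ∀ a < x.1.length,
    ((x.2.2.getD e []).getD a 0).toNat + (-((x.2.2.getD e []).getD a 0)).toNat + 1 ≤ c.2.2.2.2

/-- The bounded search for a realization of the encoded template. -/
def SearchOK (x : Code) (c : Cert) : Prop :=
  ∃ i < c.1 * numStates x.1.length (x.2.1.length - 1) c.2.2.2.2 + 1, 1 ≤ i ∧
    ∃ a < x.1.length, ∃ p ∈ tuples (List.range ((iterList x.1 i [a]).length + 1)) x.2.1.length,
      CutOK x (iterList x.1 i [a]) p

variable {γ : Type*} [Primcodable γ]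

theorem primrec_substList {f : γ → List (List ℕ)} {g : γ → List ℕ} (hf : Primrec f)
    (hg : Primrec g) : Primrec fun c => substList (f c) (g c) :=
  Primrec.list_flatMap hg (Primrec.to₂ (f := fun x : γ × ℕ => (f x.1).getD x.2 [])
    (primrec_getD (hf.comp Primrec.fst) Primrec.snd))

theorem primrec_iterList {f : γ → List (List ℕ)} {i : γ → ℕ} {g : γ → List ℕ} (hf : Primrec f)
    (hi : Primrec i) (hg : Primrec g) : Primrec fun c => iterList (f c) (i c) (g c) :=
  Primrec.nat_iterate hi hg (h := fun c => substList (f c))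
    (primrec_substList (hf.comp Primrec.fst) Primrec.snd).to₂

theorem primrec_tuples {f : γ → List ℕ} {m : γ → ℕ} (hf : Primrec f) (hm : Primrec m) :
    Primrec fun c => tuples (f c) (m c) := by
  refine Primrec.nat_iterate hm (Primrec.const [[]]) (h := fun c S =>
    (f c).flatMap fun x => S.map fun l => x :: l) ?_
  have h : Primrec fun y : (γ × List (List ℕ)) × ℕ => y.1.2.map fun l => y.2 :: l :=
    Primrec.list_map (Primrec.snd.comp Primrec.fst)
      (Primrec.list_cons.comp (Primrec.snd.comp Primrec.fst) Primrec.snd).to₂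
  exact (Primrec.list_flatMap (hf.comp Primrec.fst) h.to₂).to₂

theorem primrec_numStates {f g h : γ → ℕ} (hf : Primrec f) (hg : Primrec g) (hh : Primrec h) :
    Primrec fun c => numStates (f c) (g c) (h c) := by
  unfold numStates
  with_reducible repeat' first
    | apply primrec_mul | apply primrec_pow | apply primrec_add | apply primrec_sub
    | exact Primrec.const _ | exact hf | exact hg | exact hh

theorem primrecPred_cutOK {f : γ → Code} {g h : γ → List ℕ} (hf : Primrec f) (hg : Primrec g)
    (hh : Primrec h) : PrimrecPred fun c => CutOK (f c) (g c) (h c) := by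
  have key : PrimrecPred fun y : Code × List ℕ × List ℕ => CutOK y.1 y.2.1 y.2.2 := by
    unfold CutOK
    with_reducible repeat' first
      | apply primrecPred_and | apply primrecPred_or | apply primrecPred_forall_lt
      | apply primrecPred_eq | apply primrecPred_le | apply primrecPred_lt
      | apply primrec_getElem? | apply primrec_getD | apply primrec_count | apply primrec_take
      | apply primrec_toList | apply primrec_neg_toNat | apply primrec_toNat
      | apply primrec_length | apply primrec_mul | apply primrec_add | apply primrec_sub
      | exact Primrec.const _ | exact primrec_self | apply primrec_fst | apply primrec_snd
  exact key.comp (hf.pair (hg.pair hh))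

theorem primrecPred_hyperbolicOK {f : γ → List (List ℕ)} {g : γ → Cert} (hf : Primrec f)
    (hg : Primrec g) : PrimrecPred fun c => HyperbolicOK (f c) (g c) := by
  have key : PrimrecPred fun y : List (List ℕ) × Cert => HyperbolicOK y.1 y.2 := by
    unfold HyperbolicOK
    with_reducible repeat' first
      | apply primrecPred_and | apply primrecPred_forall_lt | apply primrecPred_eq
      | apply primrecPred_le | apply primrec_getD | apply primrec_count | apply primrec_substList
      | apply primrec_iterList | apply primrec_singleton | apply primrec_length
      | apply primrec_mul | apply primrec_add | exact Primrec.const _ | exact primrec_self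
      | apply primrec_fst | apply primrec_snd
  exact key.comp (hf.pair hg)

theorem primrecPred_boundOK {f : γ → Code} {g : γ → Cert} (hf : Primrec f)
    (hg : Primrec g) : PrimrecPred fun c => BoundOK (f c) (g c) := by
  have key : PrimrecPred fun y : Code × Cert => BoundOK y.1 y.2 := by
    unfold BoundOK
    with_reducible repeat' first
      | apply primrecPred_and | apply primrecPred_forall_lt | apply primrecPred_le
      | apply primrec_getD | apply primrec_iterList | apply primrec_neg_toNat
      | apply primrec_toNat | apply primrec_singleton | apply primrec_range
      | apply primrec_length | apply primrec_mul | apply primrec_add | apply primrec_sub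
      | exact Primrec.const _ | exact primrec_self | apply primrec_fst | apply primrec_snd
  exact key.comp (hf.pair hg)

theorem primrecPred_searchOK {f : γ → Code} {g : γ → Cert} (hf : Primrec f)
    (hg : Primrec g) : PrimrecPred fun c => SearchOK (f c) (g c) := by
  have key : PrimrecPred fun y : Code × Cert => SearchOK y.1 y.2 := by
    unfold SearchOK
    with_reducible repeat' first
      | apply primrecPred_and | apply primrecPred_exists_lt | apply primrecPred_exists_mem
      | apply primrecPred_cutOK | apply primrecPred_le | apply primrec_tuples
      | apply primrec_numStates | apply primrec_iterList | apply primrec_singleton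
      | apply primrec_range | apply primrec_length | apply primrec_mul | apply primrec_add
      | apply primrec_sub | exact Primrec.const _ | exact primrec_self | apply primrec_fst
      | apply primrec_snd
  exact key.comp (hf.pair hg)

open Classical in
/-- The search for a certificate, followed by the search for a realization that it bounds. -/
noncomputable def decideRealizable (x : Code) : Part Bool :=
  Nat.rfindOpt fun m => (Encodable.decode m : Option Cert).bind fun c =>
    if HyperbolicOK x.1 c ∧ BoundOK x c then some (decide (SearchOK x c)) else none

theorem partrec_decideRealizable : Partrec decideRealizable := by
  classical
  refine Partrec.rfindOpt (Primrec.to_comp ?_)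
  refine Primrec.option_bind (Primrec.decode.comp Primrec.snd) ?_
  refine Primrec.ite (primrecPred_and
    (primrecPred_hyperbolicOK (primrec_fst (Primrec.fst.comp Primrec.fst)) Primrec.snd)
    (primrecPred_boundOK (Primrec.fst.comp Primrec.fst) Primrec.snd)) ?_ (Primrec.const none)
  exact Primrec.option_some.comp
    (primrecPred_searchOK (Primrec.fst.comp Primrec.fst) Primrec.snd).decide

/-- The search halts because a certificate exists, and every valid certificate gives the same
answer, so it is immaterial which one is found. -/
theorem mem_decideRealizable {x : Code} {b : Prop}
    (hex : ∃ c, HyperbolicOK x.1 c ∧ BoundOK x c)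
    (h : ∀ c, HyperbolicOK x.1 c → BoundOK x c → (SearchOK x c ↔ b)) :
    ∃ r ∈ decideRealizable x, (r = true ↔ b) := by
  classical
  obtain ⟨c, hc⟩ := hex
  have hdom : (decideRealizable x).Dom := by
    rw [decideRealizable, Nat.rfindOpt_dom]
    exact ⟨Encodable.encode c, decide (SearchOK x c), by
      rw [Encodable.encodek, Option.bind_some, if_pos hc]; rfl⟩
  refine ⟨(decideRealizable x).get hdom, Part.get_mem hdom, ?_⟩
  obtain ⟨m, hm⟩ := Nat.rfindOpt_spec (Part.get_mem hdom)
  obtain ⟨c', -, hc'⟩ := Option.bind_eq_some_iff.1 hm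
  split_ifs at hc' with hok
  rw [← h c' hok.1 hok.2]
  rw [← Option.some.inj hc']
  simp

end Algorithm
end AbelianTemplates
namespace AbelianTemplates

/-! ### Agreement of the encoded conditions with the mathematical ones. -/

section Correctness

variable {n : ℕ}

theorem getD_ofFn {β : Type*} (f : Fin n → β) (d : β) (i : Fin n) :
    (List.ofFn f).getD i d = f i := by
  rw [List.getD_eq_getElem _ _ (by simp)]; simp

theorem getD_ofFn_mk {β : Type*} (f : Fin n → β) (d : β) {i : ℕ} (hi : i < n) :
    (List.ofFn f).getD i d = f ⟨i, hi⟩ := getD_ofFn f d ⟨i, hi⟩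

/-- The list of the words `g 0, …, g (n - 1)`. -/
def wordList (g : Fin n → List (Fin n)) : List (List ℕ) :=
  List.ofFn fun a => (g a).map Fin.val

theorem length_wordList (g : Fin n → List (Fin n)) : (wordList g).length = n := by
  simp [wordList]

theorem count_map_val (w : List (Fin n)) (a : Fin n) :
    (w.map Fin.val).count (a : ℕ) = w.count a :=
  List.count_map_of_injective w Fin.val Fin.val_injective a

theorem substList_map (g : Fin n → List (Fin n)) (w : List (Fin n)) :
    substList (wordList g) (w.map Fin.val) = (w.flatMap g).map Fin.val := by
  rw [substList, List.flatMap_map, List.map_flatMap]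
  congr 1
  funext a
  exact getD_ofFn _ _ _

theorem iterList_map (g : Fin n → List (Fin n)) (i : ℕ) (w : List (Fin n)) :
    iterList (wordList g) i (w.map Fin.val) = (iterSubst g i w).map Fin.val := by
  induction i with
  | zero => rfl
  | succ i ih =>
    rw [iterSubst_succ, ← substList_map, ← ih, iterList, Function.iterate_succ_apply']
    rfl

theorem iterList_singleton (g : Fin n → List (Fin n)) (i : ℕ) (a : Fin n) :
    iterList (wordList g) i [(a : ℕ)] = (iterSubst g i [a]).map Fin.val :=
  iterList_map g i [a]

/-- Iterating on the word `0 1 ⋯ (n - 1)` yields the constant `G` of the bounds at once. -/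
theorem length_iterList_range (g : Fin n → List (Fin n)) (N : ℕ) :
    (iterList (wordList g) N (List.range n)).length = ∑ c, (iterSubst g N [c]).length := by
  rw [← List.map_coe_finRange_eq_range, iterList_map, List.length_map, iterSubst_eq_flatMap,
    List.length_flatMap, Fin.sum_univ_def]

/-- The matrix of the numbers of the letters `0, …, n - 1` in the first `n` words of a list. -/
def countMatrix (n : ℕ) (P : List (List ℕ)) : Matrix (Fin n) (Fin n) ℤ :=
  Matrix.of fun b a => ((P.getD a []).count (b : ℕ) : ℤ)

theorem count_substList_map (P : List (List ℕ)) (w : List (Fin n)) (b : Fin n) :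
    ((substList P (w.map Fin.val)).count (b : ℕ) : ℤ)
      = (countMatrix n P).mulVec (parikh w) b := by
  induction w with
  | nil => simp [substList, parikh_nil]
  | cons a w ih =>
    rw [← List.singleton_append, parikh_append, Matrix.mulVec_add, Pi.add_apply, ← ih,
      parikh_singleton]
    simp [substList, countMatrix]

theorem parikh_iterSubst_singleton (g : Fin n → List (Fin n)) (N : ℕ) (a : Fin n) :
    parikh (iterSubst g N [a]) = (substMatrix g ^ N).col a := by
  rw [iterSubst_eq_flatMap, parikh_flatMap, substMatrix_iterSubst, parikh_singleton]
  simp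

/-- Counting letters after composing substitutions multiplies incidence matrices; the conditions in
`ℕ` are the matrix conditions with negative terms moved across. -/
theorem hyperbolicOK_iff {g : Fin n → List (Fin n)} {N q R : ℕ} {P Q : List (List ℕ)} :
    HyperbolicOK (wordList g) (N, q, P, Q, R) ↔ 1 ≤ N ∧ 1 ≤ q ∧
      (countMatrix n P - countMatrix n Q)
        - (countMatrix n P - countMatrix n Q) * substMatrix g ^ (2 * N)
        = (q : ℤ) • substMatrix g ^ N ∧
      ∀ b a, ((8 * n : ℕ) : ℤ) * |(countMatrix n P - countMatrix n Q) b a| ≤ q := by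
  have h1 : ∀ (P : List (List ℕ)) (a b : Fin n),
      ((substList P (iterList (wordList g) (2 * N) [(a : ℕ)])).count (b : ℕ) : ℤ)
        = (countMatrix n P * substMatrix g ^ (2 * N)) b a := by
    intro P a b
    rw [iterList_singleton, count_substList_map, parikh_iterSubst_singleton]
    rfl
  have h2 : ∀ a b : Fin n, ((iterList (wordList g) N [(a : ℕ)]).count (b : ℕ) : ℤ)
      = (substMatrix g ^ N) b a := by
    intro a b
    rw [iterList_singleton, count_map_val]
    exact congrFun (parikh_iterSubst_singleton g N a) b
  have h3 : ∀ (P : List (List ℕ)) (a b : Fin n),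
      ((P.getD a []).count (b : ℕ) : ℤ) = countMatrix n P b a := fun _ _ _ => rfl
  unfold HyperbolicOK
  simp only [length_wordList]
  refine and_congr_right fun _ => and_congr_right fun _ => ?_
  constructor
  · intro h
    have key : ∀ b a : Fin n, (countMatrix n P - countMatrix n Q
          - (countMatrix n P - countMatrix n Q) * substMatrix g ^ (2 * N)) b a
          = ((q : ℤ) • substMatrix g ^ N) b a ∧
        ((8 * n : ℕ) : ℤ) * |(countMatrix n P - countMatrix n Q) b a| ≤ q := by
      intro b a
      obtain ⟨e1, e2, e3⟩ := h a a.2 b b.2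
      zify at e1 e2 e3
      rw [h1, h1, h2, h3, h3] at e1
      rw [h3, h3] at e2 e3
      refine ⟨?_, ?_⟩
      · simp only [Matrix.sub_mul, Matrix.sub_apply, Matrix.smul_apply, smul_eq_mul]
        linarith
      · rw [← Nat.abs_cast (8 * n), ← abs_mul, abs_le, Matrix.sub_apply]
        push_cast
        constructor <;> linarith
    exact ⟨Matrix.ext fun b a => (key b a).1, fun b a => (key b a).2⟩
  · intro h a ha b hb
    have e1 := congrFun (congrFun h.1 ⟨b, hb⟩) ⟨a, ha⟩
    have e2 := h.2 ⟨b, hb⟩ ⟨a, ha⟩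
    have f1 := h1 P ⟨a, ha⟩ ⟨b, hb⟩
    have f1' := h1 Q ⟨a, ha⟩ ⟨b, hb⟩
    have f2 := h2 ⟨a, ha⟩ ⟨b, hb⟩
    have f3 := h3 P ⟨a, ha⟩ ⟨b, hb⟩
    have f3' := h3 Q ⟨a, ha⟩ ⟨b, hb⟩
    simp only at f1 f1' f2 f3 f3'
    rw [← Nat.abs_cast (8 * n), ← abs_mul, abs_le, Matrix.sub_apply] at e2
    simp only [Matrix.sub_mul, Matrix.sub_apply, Matrix.smul_apply, smul_eq_mul] at e1
    push_cast at e2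
    zify
    rw [f1, f1', f2, f3, f3']
    refine ⟨by linarith, by linarith, by linarith⟩

/-- Positive and negative parts of the entries are realized separately by words with prescribed
letter counts. -/
theorem exists_countMatrix_eq (Z : Matrix (Fin n) (Fin n) ℤ) :
    ∃ P Q : List (List ℕ), countMatrix n P - countMatrix n Q = Z := by
  have key : ∀ f : Fin n → Fin n → ℕ, ∃ P : List (List ℕ),
      ∀ b a, countMatrix n P b a = f b a := by
    intro f
    refine ⟨List.ofFn fun a => (List.finRange n).flatMap fun b => List.replicate (f b a) (b : ℕ),
      fun b a => ?_⟩
    rw [countMatrix, Matrix.of_apply, getD_ofFn, List.count_flatMap]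
    have : (List.count (b : ℕ) ∘ fun c : Fin n => List.replicate (f c a) (c : ℕ))
        = fun c => if c = b then f b a else 0 := by
      funext c
      simp only [Function.comp_apply, List.count_replicate, beq_iff_eq, Fin.val_inj]
      split_ifs with hc
      · rw [hc]
      · rfl
    rw [this, ← Fin.sum_univ_def, Finset.sum_ite_eq' Finset.univ b]
    simp
  obtain ⟨P, hP⟩ := key fun b a => (Z b a).toNat
  obtain ⟨Q, hQ⟩ := key fun b a => (-Z b a).toNat
  refine ⟨P, Q, ?_⟩
  ext b a
  rw [Matrix.sub_apply, hP, hQ]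
  exact Int.toNat_sub_toNat_neg _

theorem boundOK_iff {h : FreeMonoid (Fin n) →* FreeMonoid (Fin n)} {k : ℕ}
    {t : Template (Fin n) k} {N q R : ℕ} {P Q : List (List ℕ)} :
    BoundOK (code h t) (N, q, P, Q, R) ↔
      4 * ∑ c, (iterSubst (images h) N [c]).length
        + (∑ c, (iterSubst (images h) N [c]).length)
          * ∑ c, (iterSubst (images h) N [c]).length ≤ R ∧
      (∀ r ≤ N, ∀ a, 2 * (iterSubst (images h) r [a]).length ≤ R) ∧
      ∀ e a, |t.diffs e a| + 1 ≤ R := by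
  have e1 : (code h t).1 = wordList (images h) := rfl
  have e2 : (code h t).2.1.length = k + 1 := by simp [code]
  have e3 : (code h t).2.2 = List.ofFn fun i => List.ofFn (t.diffs i) := rfl
  unfold BoundOK
  simp only [e1, e2, e3, length_wordList, length_iterList_range]
  refine and_congr_right fun _ => and_congr ?_ ?_
  · constructor
    · intro H r hr a
      have := H r (by omega) a a.2
      rwa [iterList_singleton, List.length_map] at this
    · intro H r hr a ha
      have := H r (by omega) ⟨a, ha⟩
      rwa [← List.length_map (f := Fin.val), ← iterList_singleton] at this
  · have key : ∀ (e : Fin (k - 1)) (a : Fin n),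
        ((((List.ofFn fun i => List.ofFn (t.diffs i)).getD e []).getD a 0).toNat
          + (-((List.ofFn fun i => List.ofFn (t.diffs i)).getD e []).getD a 0).toNat + 1 ≤ R
          ↔ |t.diffs e a| + 1 ≤ R) := by
      intro e a
      rw [getD_ofFn, getD_ofFn]
      rcases abs_cases (t.diffs e a) with h | h <;> omega
    constructor
    · intro H e a
      exact (key e a).1 (H e (by omega) a a.2)
    · intro H e he a ha
      exact (key ⟨e, by omega⟩ ⟨a, ha⟩).2 (H _ _)

theorem cutOK_iff {h : FreeMonoid (Fin n) →* FreeMonoid (Fin n)} {k : ℕ}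
    {t : Template (Fin n) k} {W : List (Fin n)} {p : Fin (k + 1) → ℕ}
    (hp : ∀ i, p i ≤ W.length) :
    CutOK (code h t) (W.map Fin.val) (List.ofFn p) ↔ IsRealization W t p := by
  have e1 : (code h t).1.length = n := by simp [code]
  have e2 : (code h t).2.1 = List.ofFn fun i => (t.letters i).map Fin.val := rfl
  have e3 : (code h t).2.2 = List.ofFn fun i => List.ofFn (t.diffs i) := rfl
  have e4 : (code h t).2.1.length = k + 1 := by simp [code]
  unfold CutOK
  rw [e4, e1, e3, e2]
  have c1 : ∀ i (hi : i < k + 1), (List.ofFn p).getD i 0 = p ⟨i, hi⟩ :=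
    fun i hi => getD_ofFn_mk _ _ hi
  have c2 : ∀ i (hi : i < k + 1), (List.ofFn fun i => (t.letters i).map Fin.val).getD i none
      = (t.letters ⟨i, hi⟩).map Fin.val := fun i hi => getD_ofFn_mk _ _ hi
  have key : ∀ e : Fin (k - 1), (∀ a < n,
      (((W.map Fin.val).take ((List.ofFn p).getD (e + 2) 0)).count a
        + ((W.map Fin.val).take ((List.ofFn p).getD e 0)).count a
        + (-(((List.ofFn fun i => List.ofFn (t.diffs i)).getD e []).getD a 0)).toNat
        + ((List.ofFn fun i => (t.letters i).map Fin.val).getD e none).toList.count a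
      = 2 * ((W.map Fin.val).take ((List.ofFn p).getD (e + 1) 0)).count a
        + (((List.ofFn fun i => List.ofFn (t.diffs i)).getD e []).getD a 0).toNat
        + ((List.ofFn fun i => (t.letters i).map Fin.val).getD (e + 1) none).toList.count a)) ↔
      secondDiff W p e = t.diffs e + parikh (t.letters ⟨e + 1, by omega⟩).toList
        - parikh (t.letters ⟨e, by omega⟩).toList := by
    intro e
    rw [c1 e (by omega), c1 (e + 1) (by omega), c1 (e + 2) (by omega), c2 e (by omega),
      c2 (e + 1) (by omega), getD_ofFn, funext_iff, Fin.forall_iff]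
    refine forall₂_congr fun a ha => ?_
    have htl : ∀ o : Option (Fin n), (o.map Fin.val).toList.count a = o.toList.count ⟨a, ha⟩ := by
      intro o
      rw [← count_map_val, Option.toList_map]
    rw [getD_ofFn_mk _ _ ha, htl, htl, ← List.map_take, ← List.map_take, ← List.map_take]
    have hc : ∀ w : List (Fin n), (w.map Fin.val).count a = w.count ⟨a, ha⟩ :=
      fun w => count_map_val w ⟨a, ha⟩
    rw [hc, hc, hc]
    simp only [secondDiff, parikh, Pi.add_apply, Pi.sub_apply, nsmul_eq_mul, Nat.cast_ofNat,
      Pi.mul_apply, Pi.ofNat_apply]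
    omega
  constructor
  · rintro ⟨h1, h2, h3, h4⟩
    refine ⟨hp, fun i => ?_, fun i a ha => ?_, fun i hi => ?_, fun e => ?_⟩
    · have := h1 i (by omega)
      rwa [c1 i (by omega), c1 (i + 1) (by omega)] at this
    · have := h2 i (by omega)
      rw [c1 i (by omega), c2 i (by omega), Fin.eta, ha] at this
      simpa [Fin.val_inj] using this
    · have := h3 i (by omega)
      rw [c1 i (by omega), c1 (i + 1) (by omega), c2 i (by omega)] at this
      rcases this with h5 | h5
      · exact absurd (Option.map_eq_none_iff.1 h5) hi
      · exact not_le.2 h5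
    · exact (key e).1 (h4 e (by omega))
  · intro hr
    refine ⟨fun i hi => ?_, fun i hi => ?_, fun i hi => ?_, fun e he => ?_⟩
    · rw [c1 i (by omega), c1 (i + 1) (by omega)]
      exact hr.mono ⟨i, by omega⟩
    · rw [c1 i hi, c2 i hi]
      cases ho : t.letters ⟨i, hi⟩ with
      | none => exact Or.inl rfl
      | some a =>
        right
        rw [List.getElem?_map, hr.letter _ a ho]
    · rw [c1 i (by omega), c1 (i + 1) (by omega), c2 i (by omega)]
      by_cases ho : t.letters ⟨i, by omega⟩ = none
      · left; rw [ho]; rfl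
      · exact Or.inr (not_le.1 (hr.lt ⟨i, by omega⟩ ho))
    · exact (key ⟨e, by omega⟩).2 (hr.diff _)

theorem searchOK_iff {h : FreeMonoid (Fin n) →* FreeMonoid (Fin n)} {k : ℕ}
    {t : Template (Fin n) k} {N q R : ℕ} {P Q : List (List ℕ)} :
    SearchOK (code h t) (N, q, P, Q, R) ↔
      ∃ i < N * numStates n k R + 1, 1 ≤ i ∧
        ∃ a p, IsRealization (iterSubst (images h) i [a]) t p := by
  have e1 : (code h t).1 = wordList (images h) := rfl
  have e2 : (code h t).2.1.length = k + 1 := by simp [code]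
  unfold SearchOK
  simp only [e1, e2, length_wordList, Nat.add_sub_cancel]
  refine exists_congr fun i => and_congr_right fun _ => and_congr_right fun _ => ?_
  constructor
  · rintro ⟨a, ha, p, hp, hc⟩
    rw [mem_tuples] at hp
    obtain ⟨hl, hm⟩ := hp
    have hit := iterList_singleton (images h) i ⟨a, ha⟩
    simp only at hit
    rw [hit] at hc hm
    obtain ⟨p, rfl⟩ : ∃ p' : Fin (k + 1) → ℕ, p = List.ofFn p' :=
      ⟨fun j => p[j], by
        refine List.ext_getElem (by simp only [List.length_ofFn, hl]) fun j _ _ => ?_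
        rw [List.getElem_ofFn]; rfl⟩
    refine ⟨⟨a, ha⟩, p, (cutOK_iff fun j => ?_).1 hc⟩
    have := hm (p j) (List.mem_ofFn.2 ⟨j, rfl⟩)
    rw [List.length_map, List.mem_range] at this
    omega
  · rintro ⟨a, p, hr⟩
    refine ⟨a, a.2, List.ofFn p, ?_, ?_⟩
    · rw [mem_tuples]
      refine ⟨by simp, fun x hx => ?_⟩
      obtain ⟨j, rfl⟩ := List.mem_ofFn.1 hx
      rw [iterList_singleton, List.length_map, List.mem_range]
      exact Nat.lt_succ_of_le (hr.le_length j)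
    · rw [iterList_singleton]
      exact (cutOK_iff hr.le_length).2 hr

theorem exists_bound (h : FreeMonoid (Fin n) →* FreeMonoid (Fin n)) {k : ℕ}
    (t : Template (Fin n) k) (N q : ℕ) (P Q : List (List ℕ)) :
    ∃ R, BoundOK (code h t) (N, q, P, Q, R) := by
  set G := ∑ c, (iterSubst (images h) N [c]).length with hG
  obtain ⟨R₁, hR₁⟩ := Finite.exists_le
    fun x : Fin (N + 1) × Fin n => 2 * (iterSubst (images h) x.1 [x.2]).length
  obtain ⟨R₂, hR₂⟩ := Finite.exists_le
    fun x : Fin (k - 1) × Fin n => (|t.diffs x.1 x.2| + 1).toNat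
  refine ⟨(4 * G + G * G) + R₁ + R₂, boundOK_iff.2 ⟨?_, fun r hr a => ?_, fun e a => ?_⟩⟩
  · rw [← hG]; omega
  · have := hR₁ (⟨r, by omega⟩, a)
    simp only at this
    omega
  · have := Int.toNat_le.1 (hR₂ (e, a))
    simp only at this
    push_cast
    have : (0 : ℤ) ≤ 4 * G + G * G + R₁ := by positivity
    linarith

theorem exists_certificate (h : FreeMonoid (Fin n) →* FreeMonoid (Fin n))
    (hh : ∀ z : ℂ, IsEigenvalue h z → ‖z‖ ≠ 1) {k : ℕ} (t : Template (Fin n) k) :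
    ∃ c, HyperbolicOK (code h t).1 c ∧ BoundOK (code h t) c := by
  obtain ⟨N, q, Z, hN, hq, hZ, hZs⟩ := exists_hyperbolicity_certificate (incMatrix h) hh (8 * n)
  obtain ⟨P, Q, rfl⟩ := exists_countMatrix_eq Z
  obtain ⟨R, hR⟩ := exists_bound h t N q P Q
  exact ⟨(N, q, P, Q, R), hyperbolicOK_iff.2 ⟨hN, hq, hZ, hZs⟩, hR⟩

theorem searchOK_iff_realizable {h : FreeMonoid (Fin n) →* FreeMonoid (Fin n)} {k : ℕ}
    {t : Template (Fin n) k} {c : Cert} (hc : HyperbolicOK (code h t).1 c)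
    (hb : BoundOK (code h t) c) : SearchOK (code h t) c ↔ Realizable h t := by
  obtain ⟨N, q, P, Q, R⟩ := c
  obtain ⟨hN, hq, hZ, hZs⟩ := hyperbolicOK_iff.1 hc
  obtain ⟨hG, hR, ht⟩ := boundOK_iff.1 hb
  rw [searchOK_iff, realizable_iff_exists_isRealization hN hq hZ
    (by rw [Fintype.card_fin]; exact hZs) le_rfl hG hR t ht, Fintype.card_fin]

end Correctness
end AbelianTemplates

/-- There is one algorithm (a partial recursive function `f`) that, given any primitive morphism `h`
with no eigenvalue of absolute value `1` and any `k`-template `t₀`, halts and says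
whether some word of `Fact^∞(h)` realizes `t₀`. -/
theorem mainTheorem4 :
    ∃ f : AbelianTemplates.Code →. Bool, Partrec f ∧
      ∀ (n : ℕ) (h : FreeMonoid (Fin n) →* FreeMonoid (Fin n)),
        AbelianTemplates.IsPrimitive h →
        (∀ z : ℂ, AbelianTemplates.IsEigenvalue h z → ‖z‖ ≠ 1) →
        ∀ (k : ℕ), 1 ≤ k → ∀ t₀ : AbelianTemplates.Template (Fin n) k,
          ∃ b ∈ f (AbelianTemplates.code h t₀),
            (b = true ↔ AbelianTemplates.Realizable h t₀) :=
  ⟨AbelianTemplates.decideRealizable, AbelianTemplates.partrec_decideRealizable,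
    fun _ h _ hh _ _ t₀ => AbelianTemplates.mem_decideRealizable
      (AbelianTemplates.exists_certificate h hh t₀)
      fun _ hc hb => AbelianTemplates.searchOK_iff_realizable hc hb⟩
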